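/- Let $\Theta\subset\mathbb{R}^p$ be a nonempty connected open set and let $\alpha,\beta>0$, $0<\underline\lambda\le\bar\lambda$ be constants. For each $\theta\in\Theta$ let $f_\theta:\mathbb{R}^n\to\mathbb{R}$ be differentiable and $\alpha$-strongly convex with $\beta$-Lipschitz gradient, let $g_\theta:\mathbb{R}^m\to\mathbb{R}\cup\{+\infty\}$ be closed, convex and proper, and let $K_\theta\in\mathbb{R}^{m\times n}$ be surjective with its $m$ singular values in $[\underline\lambda,\bar\lambda]$. Write $h^*(u)=\sup_x\langle x,u\rangle-h(x)$ for the Fenchel conjugate, $K_\theta^*$ for the adjoint, and $\mathrm{prox}_h(x)=\operatorname{argmin}_u h(u)+\frac12\|x-u\|^2$. (1) For every $\theta\in\Theta$ the function $y\mapsto f_\theta^*(-K_\theta^*y)$ is finite, $(\underline\lambda^2/\beta)$-strongly convex, and differentiable with $(\bar\lambda^2/\alpha)$-Lipschitz gradient on $\mathbb{R}^m$. (2) Put $a=\underline\lambda^2/\beta$ and $b=\bar\lambda^2/\alpha$, and let $\gamma>0$ satisfy $\gamma<\frac{2a}{a+b}$ or $\gamma<\frac{2a}{(a+b)^2}$.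 Assume that $T(\theta,y):=\mathrm{prox}_{\gamma g_\theta^*}(y)$ is path differentiable jointly in $(\theta,y)\in\Theta\times\mathbb{R}^m$, that $(\theta,u)\mapsto\nabla f_\theta^*(u)$ is path differentiable jointly on $\Theta\times\mathbb{R}^n$, and that $\theta\mapsto K_\theta$ is path differentiable on $\Theta$. Then for each $\theta\in\Theta$ the dual problem $$\min_{y\in\mathbb{R}^m} f_\theta^*(-K_\theta^*y)+g_\theta^*(y)$$ has a unique solution $y^\star(\theta)$, the map $y^\star$ is path differentiable on $\Theta$, and $$\theta\mapsto\Big\{\big(\mathrm{Id}_m-V(\mathrm{Id}_m-\gamma Z)\big)^{-1}(U-\gamma VW)\;:\;[U\ V]\in\mathrm{Jac}^c_1(\theta),\ [W\ Z]\in\mathrm{Jac}^c_2(\theta)\Big\}$$ is a conservative Jacobian of $y^\star$ on $\Theta$, all the inverses in it being defined, where $$\mathrm{Jac}^c_1(\theta)=\mathrm{Jac}^c_T\big(\theta,\ y^\star(\theta)+\gamma K_\theta\nabla f_\theta^*(-K_\theta^*y^\star(\theta))\big),\qquad \mathrm{Jac}^c_2(\theta)=\mathrm{Jac}^c_{B}\big(\theta,y^\star(\theta)\big),$$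 and $B(\theta,y)=\nabla\big(f_\theta^*\circ(-K_\theta^*)\big)(y)$. Here the Clarke Jacobian $\mathrm{Jac}^c_F(x)$ is the convex hull of all limits of Jacobians $\mathrm{Jac}_F(x_k)$ along sequences $x_k\to x$ of points of differentiability of $F$. A conservative Jacobian of a locally Lipschitz map $F$ on an open set $D$ is a set-valued map $J$ on $D$ into matrices that is nonempty-valued, locally bounded, has a graph closed relative to $D$, and is such that for every absolutely continuous curve $c:[0,1]\to D$ and almost every $t$ one has $\frac{d}{dt}F(c(t))=M\dot c(t)$ for all $M\in J(c(t))$; $F$ is path differentiable on $D$ if it is locally Lipschitz and admits a conservative Jacobian there. -/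

import Mathlib

open Set Filter Topology MeasureTheory

namespace DualPathDiff

/-- Euclidean space of dimension `n`. -/
abbrev E (n : ℕ) : Type := EuclideanSpace ℝ (Fin n)

section ConvexAnalysis

variable {X : Type*} [NormedAddCommGroup X] [InnerProductSpace ℝ X]

/-- A function with values in `ℝ ∪ {+∞}` that is closed (lower semicontinuous), convex
(its epigraph is convex) and proper (never `-∞`, and finite somewhere). -/
structure IsClosedConvexProper (h : X → EReal) : Prop where
  closed : LowerSemicontinuous h
  convex : Convex ℝ {q : X × ℝ | h q.1 ≤ (q.2 : EReal)}
  ne_bot : ∀ x, h x ≠ ⊥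
  exists_ne_top : ∃ x, h x ≠ ⊤

/-- The Fenchel conjugate `h*(u) = sup_x (⟨x, u⟩ - h x)`. -/
noncomputable def conj (h : X → EReal) (u : X) : EReal :=
  ⨆ x : X, ((inner ℝ x u : ℝ) : EReal) - h x

/-- The conjugate of a real-valued function, as an extended real. -/
noncomputable def conjE (f : X → ℝ) : X → EReal :=
  conj fun x => (f x : EReal)

/-- The conjugate of a real-valued function, read as a real-valued function; to be used where the
conjugate is finite. -/
noncomputable def conjR (f : X → ℝ) (u : X) : ℝ := (conjE f u).toReal

/-- The proximal operator `prox_h(x) = argmin_u h(u) + ‖x - u‖² / 2`: some global minimizer (the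
minimizer exists and is unique when `h` is closed, convex and proper). -/
noncomputable def prox (h : X → EReal) (x : X) : X :=
  Classical.epsilon fun u : X =>
    ∀ w : X, h u + ((‖x - u‖ ^ 2 / 2 : ℝ) : EReal) ≤ h w + ((‖x - w‖ ^ 2 / 2 : ℝ) : EReal)

/-- `h` is differentiable on the whole space and its gradient is `L`-Lipschitz. -/
def HasLipschitzGradient [CompleteSpace X] (L : ℝ) (h : X → ℝ) : Prop :=
  Differentiable ℝ h ∧ ∀ x y, ‖gradient h x - gradient h y‖ ≤ L * ‖x - y‖

end ConvexAnalysis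

section ConservativeCalculus

variable {X Y : Type*} [NormedAddCommGroup X] [NormedSpace ℝ X]
  [NormedAddCommGroup Y] [NormedSpace ℝ Y]

/-- The Clarke Jacobian of `f` at `x`: the convex hull of the limits of Jacobians of `f` along
sequences of points of differentiability converging to `x`. -/
def clarkeJacobian (f : X → Y) (x : X) : Set (X →L[ℝ] Y) :=
  convexHull ℝ {L | ∃ u : ℕ → X, (∀ k, DifferentiableAt ℝ f (u k)) ∧
    Tendsto u atTop (𝓝 x) ∧ Tendsto (fun k => fderiv ℝ f (u k)) atTop (𝓝 L)}

/-- `J` is a conservative Jacobian, on the open set `D`, of the function `f`, which is locally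
Lipschitz on `D`: it is nonempty-valued, locally bounded, has a graph closed over `D`, and satisfies
the chain rule along every absolutely continuous curve `c : [0,1] → D`. -/
structure IsConservativeJacobian (D : Set X) (f : X → Y) (J : X → Set (X →L[ℝ] Y)) : Prop where
  locallyLipschitz : LocallyLipschitzOn D f
  nonempty : ∀ x ∈ D, (J x).Nonempty
  locallyBounded : ∀ x ∈ D, ∃ C : ℝ, ∀ᶠ z in 𝓝[D] x, ∀ M ∈ J z, ‖M‖ ≤ C
  graphClosed : ∀ x ∈ D, ∀ M : X →L[ℝ] Y,
    (x, M) ∈ closure {q : X × (X →L[ℝ] Y) | q.1 ∈ D ∧ q.2 ∈ J q.1} → M ∈ J x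
  chainRule : ∀ c : ℝ → X, AbsolutelyContinuousOnInterval c 0 1 → (∀ t ∈ Icc (0 : ℝ) 1, c t ∈ D) →
    ∀ᵐ t ∂(volume.restrict (Icc (0 : ℝ) 1)), ∀ M ∈ J (c t),
      HasDerivAt (fun s => f (c s)) (M (deriv c t)) t

/-- `f` is path differentiable on the open set `D`: it is locally Lipschitz there and admits a
conservative Jacobian. -/
def PathDifferentiableOn (D : Set X) (f : X → Y) : Prop :=
  LocallyLipschitzOn D f ∧ ∃ J : X → Set (X →L[ℝ] Y), IsConservativeJacobian D f J

end ConservativeCalculus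

section Problem

variable {p n m : ℕ}

/-- The smooth part `y ↦ f*(-K* y)` of the dual objective, as an extended real. -/
noncomputable def dualSmoothE (f : E n → ℝ) (K : E n →L[ℝ] E m) (y : E m) : EReal :=
  conjE f (-(ContinuousLinearMap.adjoint K y))

/-- The smooth part `y ↦ f*(-K* y)` of the dual objective, as a real number. -/
noncomputable def dualSmooth (f : E n → ℝ) (K : E n →L[ℝ] E m) (y : E m) : ℝ :=
  conjR f (-(ContinuousLinearMap.adjoint K y))

/-- `y` minimizes `f*(-K* y) + g*(y)`, i.e. solves the Fenchel-Rockafellar dual of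
`min_x f(x) + g(K x)`. -/
def IsDualSolution (f : E n → ℝ) (g : E m → EReal) (K : E n →L[ℝ] E m) (y : E m) : Prop :=
  ∀ z : E m, dualSmoothE f K y + conj g y ≤ dualSmoothE f K z + conj g z

/-- The map `T(θ, y) = prox_{γ g_θ*}(y)`. -/
noncomputable def proxMap (γ : ℝ) (g : E p → E m → EReal) (q : E p × E m) : E m :=
  prox (fun u => (γ : EReal) * conj (g q.1) u) q.2

/-- The map `(θ, u) ↦ ∇ f_θ* (u)`. -/
noncomputable def gradConj (f : E p → E n → ℝ) (q : E p × E n) : E n :=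
  gradient (conjR (f q.1)) q.2

/-- The map `(θ, y) ↦ ∇ (f_θ* ∘ (-K_θ*)) (y)`. -/
noncomputable def gradDualSmooth (f : E p → E n → ℝ) (K : E p → E n →L[ℝ] E m)
    (q : E p × E m) : E m :=
  gradient (dualSmooth (f q.1) (K q.1)) q.2

/-- The set of all `(I - V (I - γ Z))⁻¹ (U - γ V W)` with `[U V] ∈ J₁` and `[W Z] ∈ J₂`. -/
noncomputable def implicitJacobian (γ : ℝ) (J₁ J₂ : Set (E p × E m →L[ℝ] E m)) :
    Set (E p →L[ℝ] E m) :=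
  {M | ∃ (U W : E p →L[ℝ] E m) (V Z : E m →L[ℝ] E m),
    U.coprod V ∈ J₁ ∧ W.coprod Z ∈ J₂ ∧
    M = (ContinuousLinearMap.inverse
      (ContinuousLinearMap.id ℝ (E m) - V ∘L (ContinuousLinearMap.id ℝ (E m) - γ • Z))) ∘L
        (U - γ • (V ∘L W))}

end Problem

end DualPathDiff

/-! The dual solution is the fixed point y = T(θ, y - γ B(θ, y)) of the forward-backward map, and
the proof is an implicit function argument resting on monotonicity. T(θ, ·) is a proximal map, hence
firmly nonexpansive; B(θ, ·) is the gradient of the smooth dual term, hence a-strongly monotone and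
b-Lipschitz. These inequalities confine difference quotients to closed convex sets, so they pass to
the Clarke Jacobians: ‖V w‖² ≤ ⟨w, V w⟩ and a‖v‖² ≤ ⟨v, Z v⟩. If v = V(v - γ Z v), then ‖v‖² ≤ ⟨v -
γ Z v, v⟩, so ⟨v, Z v⟩ ≤ 0 and v = 0: the matrix to be inverted is injective
(`isInvertible_id_sub_comp`). The same computation with increments bounds the distance to the fixed
point by the residual (`mul_norm_sub_le_of_fixedPoint`), which makes the solution locally Lipschitz.

Along an absolutely continuous curve the solution is then absolutely continuous as well. The chain
rules for T and B along the lifted curves give, almost everywhere, a linear equation for its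
velocity, and solving it yields the stated formula (`isConservativeJacobian_of_fixedPoint`).

Three supports remain. The Clarke Jacobian of a path differentiable map is itself conservative
(`IsConservativeJacobian.clarkeJacobian`). Path differentiability survives composition, which covers
B = -K ∇f*(-K* ·). Finally, conjugacy exchanges strong convexity and smoothness of f, and the
singular values of K transfer the constants to the dual. -/

namespace DualPathDiff

/-! ### Upper semicontinuous set-valued maps with compact values -/

section UpperCompact

variable {X A B C : Type*} [TopologicalSpace X] [TopologicalSpace A] [TopologicalSpace B]
  [TopologicalSpace C]

/-- Sequential form of upper semicontinuity with compact values on `D`: any sequence of values over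
a sequence of points converging in `D` clusters at a value over the limit. -/
def UpperCompactOn (D : Set X) (S : X → Set A) : Prop :=
  ∀ x ∈ D, ∀ (u : ℕ → X) (a : ℕ → A), (∀ k, u k ∈ D) → (∀ k, a k ∈ S (u k)) →
    Tendsto u atTop (𝓝 x) →
    ∃ l ∈ S x, ∃ φ : ℕ → ℕ, StrictMono φ ∧ Tendsto (a ∘ φ) atTop (𝓝 l)

theorem UpperCompactOn.of_singleton {D : Set X} {s : X → A} (hs : ContinuousOn s D) :
    UpperCompactOn D fun x => {s x} := by
  intro x hx u a hu ha hux
  refine ⟨s x, rfl, id, strictMono_id, ?_⟩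
  have h : a ∘ id = fun k => s (u k) := funext ha
  rw [h]
  exact (hs x hx).tendsto.comp (tendsto_nhdsWithin_iff.2 ⟨hux, Eventually.of_forall hu⟩)

theorem UpperCompactOn.of_isCompact {A : Type*} [PseudoMetricSpace A] {D : Set X} {s : Set A}
    (hs : IsCompact s) : UpperCompactOn D fun _ => s := by
  intro x _ u a _ ha _
  exact hs.isSeqCompact ha

theorem UpperCompactOn.prod {D : Set X} {S : X → Set A} {T : X → Set B}
    (hS : UpperCompactOn D S) (hT : UpperCompactOn D T) :
    UpperCompactOn D fun x => S x ×ˢ T x := by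
  intro x hx u a hu ha hux
  obtain ⟨l, hl, φ, hφ, hφl⟩ := hS x hx u (fun k => (a k).1) hu (fun k => (ha k).1) hux
  obtain ⟨l', hl', ψ, hψ, hψl⟩ := hT x hx (u ∘ φ) (fun k => (a (φ k)).2) (fun k => hu _)
    (fun k => (ha _).2) (hux.comp hφ.tendsto_atTop)
  exact ⟨(l, l'), ⟨hl, hl'⟩, φ ∘ ψ, hφ.comp hψ,
    (hφl.comp hψ.tendsto_atTop).prodMk_nhds hψl⟩

theorem UpperCompactOn.pi {D : Set X} {S : X → Set A} (hS : UpperCompactOn D S) (N : ℕ) :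
    UpperCompactOn D fun x => {z : Fin N → A | ∀ i, z i ∈ S x} := by
  induction N with
  | zero =>
    intro x _ u a _ _ _
    exact ⟨finZeroElim, fun i => i.elim0, id, strictMono_id,
      tendsto_pi_nhds.2 fun i => i.elim0⟩
  | succ N ih =>
    intro x hx u a hu ha hux
    obtain ⟨⟨l, l'⟩, ⟨hl, hl'⟩, φ, hφ, hφl⟩ := (hS.prod ih) x hx u
      (fun k => (a k 0, fun i => a k i.succ)) hu (fun k => ⟨ha k 0, fun i => ha k _⟩) hux
    refine ⟨Fin.cons l l', Fin.cases hl hl', φ, hφ, tendsto_pi_nhds.2 ?_⟩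
    refine Fin.cases ?_ fun i => ?_
    · exact (continuous_fst.tendsto _).comp hφl
    · exact ((continuous_apply i).tendsto _).comp ((continuous_snd.tendsto _).comp hφl)

/-- Continuity of `Φ` is asked only at values that occur, so that `Φ` may involve a matrix inverse.
-/
theorem UpperCompactOn.image {D : Set X} {S : X → Set A} (hS : UpperCompactOn D S) {Φ : A → B}
    (hΦ : ∀ x ∈ D, ∀ a ∈ S x, ContinuousAt Φ a) : UpperCompactOn D fun x => Φ '' S x := by
  intro x hx u b hu hb hux
  choose a ha hab using hb
  obtain ⟨l, hl, φ, hφ, hφl⟩ := hS x hx u a hu ha hux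
  refine ⟨Φ l, ⟨l, hl, rfl⟩, φ, hφ, ?_⟩
  have h : b ∘ φ = Φ ∘ (a ∘ φ) := by
    funext k
    exact (hab _).symm
  rw [h]
  exact (hΦ x hx l hl).tendsto.comp hφl

theorem UpperCompactOn.comp {D : Set X} {D' : Set B} {S : B → Set A} (hS : UpperCompactOn D' S)
    {s : X → B} (hs : ContinuousOn s D) (hD : MapsTo s D D') :
    UpperCompactOn D fun x => S (s x) := by
  intro x hx u a hu ha hux
  exact hS (s x) (hD hx) (s ∘ u) a (fun k => hD (hu k)) ha
    ((hs x hx).tendsto.comp (tendsto_nhdsWithin_iff.2 ⟨hux, Eventually.of_forall hu⟩))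

end UpperCompact

section ConvexHull

variable {A : Type*} [NormedAddCommGroup A] [NormedSpace ℝ A] [FiniteDimensional ℝ A]

/-- Carathéodory's theorem with a fixed number of points. -/
theorem convexHull_eq_image_stdSimplex (s : Set A) :
    convexHull ℝ s =
      (fun q : (Fin (Module.finrank ℝ A + 1) → ℝ) × (Fin (Module.finrank ℝ A + 1) → A) =>
        ∑ i, q.1 i • q.2 i) ''
      (stdSimplex ℝ (Fin (Module.finrank ℝ A + 1)) ×ˢ {z | ∀ i, z i ∈ s}) := by
  apply Subset.antisymm
  · intro x hx
    obtain ⟨ι, _, z, w, hz, hai, hw, hw1, hwx⟩ := eq_pos_convex_span_of_mem_convexHull hx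
    have hcard : Fintype.card ι ≤ Module.finrank ℝ A + 1 := by
      refine hai.card_le_finrank_succ.trans ?_
      gcongr
      exact Submodule.finrank_le _
    obtain ⟨e⟩ : Nonempty (ι ↪ Fin (Module.finrank ℝ A + 1)) := by
      apply Function.Embedding.nonempty_of_card_le
      simpa using hcard
    obtain ⟨y, hy⟩ : s.Nonempty := by
      by_contra! h
      simp [h] at hx
    -- Unused slots receive weight 0 and the dummy point `y` of `s`.
    refine ⟨(Function.extend e w 0, Function.extend e z fun _ => y), ⟨⟨?_, ?_⟩, ?_⟩, ?_⟩
    · intro j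
      by_cases hj : ∃ i, e i = j
      · obtain ⟨i, rfl⟩ := hj
        simpa [e.injective.extend_apply] using (hw i).le
      · simp [Function.extend_apply' _ _ _ hj]
    · rw [← hw1]
      refine (Fintype.sum_of_injective e e.injective _ _ (fun j hj => ?_) fun i => ?_).symm
      · simp [Function.extend_apply' _ _ _ hj]
      · simp [e.injective.extend_apply]
    · intro j
      by_cases hj : ∃ i, e i = j
      · obtain ⟨i, rfl⟩ := hj
        simpa [e.injective.extend_apply] using hz ⟨i, rfl⟩
      · simpa [Function.extend_apply' _ _ _ hj] using hy
    · rw [← hwx]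
      refine (Fintype.sum_of_injective e e.injective _ _ (fun j hj => ?_) fun i => ?_).symm
      · simp [Function.extend_apply' _ _ _ hj]
      · simp [e.injective.extend_apply]
  · rintro _ ⟨⟨w, z⟩, ⟨hw, hz⟩, rfl⟩
    exact (convex_convexHull ℝ s).sum_mem (fun i _ => hw.1 i) hw.2
      fun i _ => subset_convexHull ℝ s (hz i)

/-- With the number of points fixed by Carathéodory, the hull is a continuous image of a compact
simplex times a finite power of `S x`. -/
theorem UpperCompactOn.convexHull {X : Type*} [TopologicalSpace X] {D : Set X} {S : X → Set A}
    (hS : UpperCompactOn D S) : UpperCompactOn D fun x => convexHull ℝ (S x) := by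
  simp_rw [convexHull_eq_image_stdSimplex]
  refine ((UpperCompactOn.of_isCompact (isCompact_stdSimplex ℝ _)).prod (hS.pi _)).image ?_
  intro x _ a _
  apply Continuous.continuousAt
  fun_prop

end ConvexHull

section Bounded

variable {X A : Type*} [NormedAddCommGroup X] [NormedAddCommGroup A]

/-- Bolzano–Weierstrass. With the converses `UpperCompactOn.locallyBounded` and
`UpperCompactOn.graphClosed`, it replaces two axioms of a conservative Jacobian by one property
stable under products, images and hulls. -/
theorem UpperCompactOn.of_bounded_closed [ProperSpace A] {D : Set X} {S : X → Set A}
    (hb : ∀ x ∈ D, ∃ C : ℝ, ∀ᶠ z in 𝓝[D] x, ∀ M ∈ S z, ‖M‖ ≤ C)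
    (hc : ∀ x ∈ D, ∀ M : A, (x, M) ∈ closure {q : X × A | q.1 ∈ D ∧ q.2 ∈ S q.1} → M ∈ S x) :
    UpperCompactOn D S := by
  intro x hx u a hu ha hux
  obtain ⟨C, hC⟩ := hb x hx
  have hev : ∀ᶠ k in atTop, a k ∈ Metric.closedBall (0 : A) C := by
    filter_upwards [(tendsto_nhdsWithin_iff.2 ⟨hux, Eventually.of_forall hu⟩).eventually hC]
      with k hk
    simpa using hk _ (ha k)
  obtain ⟨l, -, φ, hφ, hφl⟩ := tendsto_subseq_of_frequently_bounded
    (Metric.isBounded_closedBall (x := (0 : A)) (r := C)) hev.frequently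
  refine ⟨l, hc x hx l ?_, φ, hφ, hφl⟩
  refine mem_closure_of_tendsto ((hux.comp hφ.tendsto_atTop).prodMk_nhds hφl)
    (Eventually.of_forall fun k => ⟨hu _, ha _⟩)

theorem UpperCompactOn.locallyBounded {D : Set X} {S : X → Set A} (hS : UpperCompactOn D S) :
    ∀ x ∈ D, ∃ C : ℝ, ∀ᶠ z in 𝓝[D] x, ∀ M ∈ S z, ‖M‖ ≤ C := by
  intro x hx
  by_contra! h
  have h' : ∀ k : ℕ, ∃ z ∈ D, dist z x < 1 / (k + 1) ∧ ∃ M ∈ S z, (k : ℝ) < ‖M‖ := by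
    intro k
    obtain ⟨z, hz, hzD, hzx⟩ := ((h k).and_eventually (inter_mem self_mem_nhdsWithin
      (mem_nhdsWithin_of_mem_nhds (Metric.ball_mem_nhds x (by positivity : (0:ℝ) < 1 / (k + 1)))))).exists
    exact ⟨z, hzD, hzx, hz⟩
  choose u hu hux a ha hak using h'
  have hlim : Tendsto u atTop (𝓝 x) :=
    tendsto_iff_dist_tendsto_zero.2 <| squeeze_zero (fun _ => dist_nonneg) (fun k => (hux k).le)
      tendsto_one_div_add_atTop_nhds_zero_nat
  obtain ⟨l, -, φ, hφ, hφl⟩ := hS x hx u a hu ha hlim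
  refine not_tendsto_nhds_of_tendsto_atTop ?_ _ hφl.norm
  exact tendsto_atTop_mono (fun k => (hak (φ k)).le)
    (tendsto_natCast_atTop_atTop.comp hφ.tendsto_atTop)

theorem UpperCompactOn.graphClosed {D : Set X} {S : X → Set A} (hS : UpperCompactOn D S) :
    ∀ x ∈ D, ∀ M : A, (x, M) ∈ closure {q : X × A | q.1 ∈ D ∧ q.2 ∈ S q.1} → M ∈ S x := by
  intro x hx M hM
  obtain ⟨q, hq, hqM⟩ := mem_closure_iff_seq_limit.1 hM
  obtain ⟨l, hl, φ, hφ, hφl⟩ := hS x hx (fun k => (q k).1) (fun k => (q k).2)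
    (fun k => (hq k).1) (fun k => (hq k).2) ((continuous_fst.tendsto _).comp hqM)
  have : l = M := tendsto_nhds_unique hφl
    (((continuous_snd.tendsto _).comp hqM).comp hφ.tendsto_atTop)
  exact this ▸ hl

/-- Values near `x` are close to values at `x`. -/
theorem UpperCompactOn.eventually_mem {D : Set X} {S : X → Set A} (hS : UpperCompactOn D S)
    {x : X} (hx : x ∈ D) {O : Set A} (hO : IsOpen O) (hSO : S x ⊆ O) :
    ∀ᶠ z in 𝓝[D] x, S z ⊆ O := by
  by_contra h
  have h' : ∀ k : ℕ, ∃ z ∈ D, dist z x < 1 / (k + 1) ∧ ∃ M ∈ S z, M ∉ O := by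
    intro k
    obtain ⟨z, hz, hzD, hzx⟩ := ((not_eventually.1 h).and_eventually (inter_mem self_mem_nhdsWithin
      (mem_nhdsWithin_of_mem_nhds (Metric.ball_mem_nhds x (by positivity : (0:ℝ) < 1 / (k + 1)))))).exists
    exact ⟨z, hzD, hzx, not_subset.1 hz⟩
  choose u hu hux a ha hak using h'
  have hlim : Tendsto u atTop (𝓝 x) :=
    tendsto_iff_dist_tendsto_zero.2 <| squeeze_zero (fun _ => dist_nonneg) (fun k => (hux k).le)
      tendsto_one_div_add_atTop_nhds_zero_nat
  obtain ⟨l, hl, φ, hφ, hφl⟩ := hS x hx u a hu ha hlim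
  obtain ⟨k, hk⟩ := (hφl.eventually (hO.mem_nhds (hSO hl))).exists
  exact hak _ hk

end Bounded

end DualPathDiff

namespace DualPathDiff

/-! ### Absolutely continuous curves -/

section Curves

variable {X Y : Type*}

theorem _root_.LipschitzOnWith.comp_absolutelyContinuousOnInterval
    [PseudoMetricSpace X] [PseudoMetricSpace Y] {F : X → Y} {K : NNReal} {s : Set X}
    (hF : LipschitzOnWith K F s) {c : ℝ → X} {a b : ℝ} (hc : AbsolutelyContinuousOnInterval c a b)
    (hs : MapsTo c (uIcc a b) s) : AbsolutelyContinuousOnInterval (fun t => F (c t)) a b := by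
  have h0 : Tendsto (fun E : ℕ × (ℕ → ℝ × ℝ) =>
      K * ∑ i ∈ Finset.range E.1, dist (c (E.2 i).1) (c (E.2 i).2))
      (AbsolutelyContinuousOnInterval.totalLengthFilter ⊓
        𝓟 (AbsolutelyContinuousOnInterval.disjWithin a b)) (𝓝 0) := by
    simpa using Tendsto.const_mul (K : ℝ) hc
  refine squeeze_zero' (Eventually.of_forall fun E => Finset.sum_nonneg fun i _ => dist_nonneg)
    ?_ h0
  filter_upwards [mem_inf_of_right (mem_principal_self _)] with E hE
  rw [Finset.mul_sum]
  exact Finset.sum_le_sum fun i hi =>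
    hF.dist_le_mul _ (hs (hE.1 i hi).1) _ (hs (hE.1 i hi).2)

/-- The trace of the curve is compact, and on a compact set a locally Lipschitz map is Lipschitz. -/
theorem _root_.LocallyLipschitzOn.comp_absolutelyContinuousOnInterval
    [SeminormedAddCommGroup X] [PseudoMetricSpace Y] {F : X → Y} {s : Set X}
    (hF : LocallyLipschitzOn s F) {c : ℝ → X} {a b : ℝ} (hc : AbsolutelyContinuousOnInterval c a b)
    (hs : MapsTo c (uIcc a b) s) : AbsolutelyContinuousOnInterval (fun t => F (c t)) a b := by
  obtain ⟨K, hK⟩ := (hF.mono hs.image_subset).exists_lipschitzOnWith_of_compact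
    (isCompact_uIcc.image_of_continuousOn hc.continuousOn)
  exact hK.comp_absolutelyContinuousOnInterval hc (mapsTo_image _ _)

theorem _root_.AbsolutelyContinuousOnInterval.prodMk [PseudoMetricSpace X] [PseudoMetricSpace Y]
    {c : ℝ → X} {e : ℝ → Y} {a b : ℝ} (hc : AbsolutelyContinuousOnInterval c a b)
    (he : AbsolutelyContinuousOnInterval e a b) :
    AbsolutelyContinuousOnInterval (fun t => (c t, e t)) a b := by
  refine squeeze_zero (fun E => Finset.sum_nonneg fun i _ => dist_nonneg) (fun E => ?_)
    (by simpa using Tendsto.add hc he)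
  rw [← Finset.sum_add_distrib]
  refine Finset.sum_le_sum fun i _ => ?_
  rw [Prod.dist_eq]
  exact max_le_add_of_nonneg dist_nonneg dist_nonneg

theorem _root_.LocallyLipschitzOn.exists_ball
    [SeminormedAddCommGroup X] [PseudoMetricSpace Y] {D : Set X} {f : X → Y}
    (hD : IsOpen D) (hf : LocallyLipschitzOn D f) {x : X}
    (hx : x ∈ D) : ∃ r > 0, ∃ K : NNReal, Metric.ball x r ⊆ D ∧
      LipschitzOnWith K f (Metric.ball x r) := by
  obtain ⟨K, t, ht, hK⟩ := hf hx
  rw [hD.nhdsWithin_eq hx] at ht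
  obtain ⟨r, hr, hrt⟩ := Metric.mem_nhds_iff.1 (inter_mem ht (hD.mem_nhds hx))
  exact ⟨r, hr, K, fun z hz => (hrt hz).2, hK.mono fun z hz => (hrt hz).1⟩

variable [NormedAddCommGroup Y] [NormedSpace ℝ Y]

/-- Mean value inequality for absolutely continuous curves. -/
theorem norm_sub_sub_le_of_ae_hasDerivAt {g : ℝ → Y} (hg : AbsolutelyContinuousOnInterval g 0 1)
    {d : Y} {ε : ℝ}
    (h : ∀ᵐ t ∂(volume.restrict (Icc (0 : ℝ) 1)), ∃ g', HasDerivAt g g' t ∧ ‖g' - d‖ ≤ ε) :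
    ‖g 1 - g 0 - d‖ ≤ ε := by
  -- A norming functional reduces the claim to a scalar function, to which the fundamental theorem
  -- of calculus applies.
  obtain ⟨w, hw1, hw⟩ := exists_dual_vector'' ℝ (g 1 - g 0 - d)
  have hwlip : LipschitzOnWith ‖w‖₊ w univ := w.lipschitz.lipschitzOnWith
  have hid : AbsolutelyContinuousOnInterval (fun t : ℝ => t * w d) 0 1 := by
    apply ContDiffOn.absolutelyContinuousOnInterval
    fun_prop
  have hφ : AbsolutelyContinuousOnInterval (fun t => w (g t) - t * w d) 0 1 :=
    (hwlip.comp_absolutelyContinuousOnInterval hg (mapsTo_univ _ _)).sub hid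
  have hint := hφ.integral_deriv_eq_sub
  have hle : ‖∫ t in (0 : ℝ)..1, deriv (fun t => w (g t) - t * w d) t‖ ≤ ε * |1 - 0| := by
    apply intervalIntegral.norm_integral_le_of_norm_le_const_ae
    rw [ae_restrict_iff' measurableSet_Icc] at h
    filter_upwards [h] with t ht htI
    rw [uIoc_of_le zero_le_one] at htI
    obtain ⟨g', hg', hle⟩ := ht (Ioc_subset_Icc_self htI)
    have h1 : HasDerivAt (fun t => w (g t) - t * w d) (w g' - 1 * w d) t :=
      (w.hasFDerivAt.comp_hasDerivAt t hg').sub ((hasDerivAt_id t).mul_const _)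
    rw [h1.deriv, one_mul, ← map_sub]
    calc ‖w (g' - d)‖ ≤ ‖w‖ * ‖g' - d‖ := w.le_opNorm _
      _ ≤ 1 * ‖g' - d‖ := by gcongr
      _ ≤ ε := by simpa using hle
  rw [hint] at hle
  have h2 : w (g 1) - 1 * w d - (w (g 0) - 0 * w d) = ‖g 1 - g 0 - d‖ := by
    have h3 : w (g 1 - g 0 - d) = ‖g 1 - g 0 - d‖ := by simpa using hw
    rw [← h3]
    simp only [map_sub]
    ring
  rw [h2] at hle
  simpa using hle

end Curves

/-! ### The Clarke Jacobian is conservative -/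

section Clarke

variable {X Y : Type*} [NormedAddCommGroup X] [NormedSpace ℝ X]
  [NormedAddCommGroup Y] [NormedSpace ℝ Y]

/-- The limits of Jacobians whose convex hull is the Clarke Jacobian. -/
def derivLimits (f : X → Y) (x : X) : Set (X →L[ℝ] Y) :=
  {L | ∃ u : ℕ → X, (∀ k, DifferentiableAt ℝ f (u k)) ∧
    Tendsto u atTop (𝓝 x) ∧ Tendsto (fun k => fderiv ℝ f (u k)) atTop (𝓝 L)}

/-- The graph of `derivLimits f` is a closure, hence closed. -/
theorem mem_derivLimits_iff {f : X → Y} {x : X} {L : X →L[ℝ] Y} :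
    L ∈ derivLimits f x ↔
      (x, L) ∈ closure {q : X × (X →L[ℝ] Y) | DifferentiableAt ℝ f q.1 ∧ q.2 = fderiv ℝ f q.1} := by
  rw [mem_closure_iff_seq_limit]
  constructor
  · rintro ⟨u, hu, hux, huL⟩
    exact ⟨fun k => (u k, fderiv ℝ f (u k)), fun k => ⟨hu k, rfl⟩, hux.prodMk_nhds huL⟩
  · rintro ⟨q, hq, hqx⟩
    refine ⟨fun k => (q k).1, fun k => (hq k).1, (continuous_fst.tendsto _).comp hqx, ?_⟩
    refine ((continuous_snd.tendsto _).comp hqx).congr fun k => (hq k).2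

theorem clarkeJacobian_subset {f : X → Y} {x : X} {C : Set (X →L[ℝ] Y)} (hC : IsClosed C)
    (hconv : Convex ℝ C) (h : ∀ᶠ z in 𝓝 x, DifferentiableAt ℝ f z → fderiv ℝ f z ∈ C) :
    clarkeJacobian f x ⊆ C := by
  refine convexHull_min ?_ hconv
  rintro L ⟨u, hu, hux, huL⟩
  refine hC.mem_of_tendsto huL ?_
  filter_upwards [hux.eventually h] with k hk using hk (hu k)

/-- A closed convex set containing the difference quotients of `f` near `x` in the direction `v`
contains the values at `v` of the Clarke Jacobian. -/
theorem clarkeJacobian_apply_mem {f : X → Y} {x v : X} {C : Set Y} (hC : IsClosed C)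
    (hconv : Convex ℝ C)
    (h : ∀ᶠ z in 𝓝 x, ∀ᶠ t : ℝ in 𝓝[>] 0, t⁻¹ • (f (z + t • v) - f z) ∈ C)
    {L : X →L[ℝ] Y} (hL : L ∈ clarkeJacobian f x) : L v ∈ C := by
  let ev : (X →L[ℝ] Y) →L[ℝ] Y := ContinuousLinearMap.apply ℝ Y v
  refine clarkeJacobian_subset (C := ev ⁻¹' C) (hC.preimage ev.continuous)
    (hconv.linear_preimage ev.toLinearMap) ?_ hL
  filter_upwards [h] with z hz hdiff
  exact hC.mem_of_tendsto (hdiff.hasFDerivAt.hasLineDerivAt v).tendsto_slope_zero_right hz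

variable {D : Set X} {f : X → Y} {J : X → Set (X →L[ℝ] Y)}

theorem IsConservativeJacobian.of_upperCompactOn (hf : LocallyLipschitzOn D f)
    (hne : ∀ x ∈ D, (J x).Nonempty) (hJ : UpperCompactOn D J)
    (hchain : ∀ c : ℝ → X, AbsolutelyContinuousOnInterval c 0 1 → (∀ t ∈ Icc (0 : ℝ) 1, c t ∈ D) →
      ∀ᵐ t ∂(volume.restrict (Icc (0 : ℝ) 1)), ∀ M ∈ J (c t),
        HasDerivAt (fun s => f (c s)) (M (deriv c t)) t) :
    IsConservativeJacobian D f J :=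
  ⟨hf, hne, hJ.locallyBounded, hJ.graphClosed, hchain⟩

/-- First-order expansion of `f` along a segment on which `J` nearly determines the directional
derivative. -/
theorem IsConservativeJacobian.norm_sub_sub_le (hJ : IsConservativeJacobian D f J) {z w : X} {d : Y}
    {ε : ℝ} (hseg : ∀ s ∈ Icc (0 : ℝ) 1, z + s • w ∈ D)
    (h : ∀ s ∈ Icc (0 : ℝ) 1, ∀ N ∈ J (z + s • w), ‖N w - d‖ ≤ ε) :
    ‖f (z + w) - f z - d‖ ≤ ε := by
  have hc : AbsolutelyContinuousOnInterval (fun s : ℝ => z + s • w) 0 1 := by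
    apply ContDiffOn.absolutelyContinuousOnInterval
    fun_prop
  have hderiv : ∀ t : ℝ, deriv (fun s : ℝ => z + s • w) t = w := fun t => by
    have : HasDerivAt (fun s : ℝ => z + s • w) ((1 : ℝ) • w) t :=
      ((hasDerivAt_id t).smul_const w).const_add z
    simpa using this.deriv
  have hfc : AbsolutelyContinuousOnInterval (fun s : ℝ => f (z + s • w)) 0 1 :=
    hJ.locallyLipschitz.comp_absolutelyContinuousOnInterval hc
      (by rw [uIcc_of_le zero_le_one]; exact hseg)
  have := norm_sub_sub_le_of_ae_hasDerivAt (d := d) (ε := ε) hfc ?_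
  · simpa using this
  · filter_upwards [hJ.chainRule _ hc hseg, ae_restrict_mem measurableSet_Icc] with t ht htI
    obtain ⟨N, hN⟩ := hJ.nonempty _ (hseg t htI)
    have h1 := ht N hN
    rw [hderiv] at h1
    exact ⟨_, h1, h t htI N hN⟩

variable [FiniteDimensional ℝ X] [FiniteDimensional ℝ Y]

theorem upperCompactOn_derivLimits (hD : IsOpen D) (hf : LocallyLipschitzOn D f) :
    UpperCompactOn D (derivLimits f) := by
  have : ProperSpace (X →L[ℝ] Y) := FiniteDimensional.proper_real _
  apply UpperCompactOn.of_bounded_closed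
  · intro x hx
    obtain ⟨r, hr, K, -, hK⟩ := hf.exists_ball hD hx
    refine ⟨K, mem_nhdsWithin_of_mem_nhds ?_⟩
    filter_upwards [Metric.ball_mem_nhds x hr] with z hz L hL
    obtain ⟨u, hu, huz, huL⟩ := hL
    refine le_of_tendsto huL.norm ?_
    filter_upwards [huz.eventually (Metric.isOpen_ball.mem_nhds hz)] with k hk
    exact norm_fderiv_le_of_lipschitzOn ℝ (Metric.isOpen_ball.mem_nhds hk) hK
  · intro x hx L hL
    rw [mem_derivLimits_iff]
    refine closure_minimal ?_ isClosed_closure hL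
    rintro ⟨z, M⟩ ⟨-, hM⟩
    exact mem_derivLimits_iff.1 hM

theorem upperCompactOn_clarkeJacobian (hD : IsOpen D) (hf : LocallyLipschitzOn D f) :
    UpperCompactOn D (clarkeJacobian f) :=
  (upperCompactOn_derivLimits hD hf).convexHull

/-- Rademacher's theorem supplies differentiability points arbitrarily close to `x`; the derivatives
there are bounded by the Lipschitz constant and so have a cluster point. -/
theorem clarkeJacobian_nonempty (hD : IsOpen D) (hf : LocallyLipschitzOn D f) {x : X}
    (hx : x ∈ D) : (clarkeJacobian f x).Nonempty := by
  have : ProperSpace (X →L[ℝ] Y) := FiniteDimensional.proper_real _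
  let : MeasurableSpace X := borel X
  have : BorelSpace X := ⟨rfl⟩
  obtain ⟨r, hr, K, -, hK⟩ := hf.exists_ball hD hx
  have hae := hK.ae_differentiableWithinAt_of_mem (μ := Measure.addHaar)
  have hex : ∀ k : ℕ, ∃ z ∈ Metric.ball x r, dist z x < 1 / (k + 1) ∧ DifferentiableAt ℝ f z := by
    intro k
    have hpos : 0 < min r (1 / ((k : ℝ) + 1)) := lt_min hr (by positivity)
    obtain ⟨z, hz1, hz2⟩ := (Measure.dense_of_ae hae).inter_open_nonempty _ Metric.isOpen_ball
      (Metric.nonempty_ball.2 hpos)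
    have hzr : z ∈ Metric.ball x r := Metric.ball_subset_ball (min_le_left _ _) hz1
    exact ⟨z, hzr, (Metric.mem_ball.1 hz1).trans_le (min_le_right _ _),
      (hz2 hzr).differentiableAt (Metric.isOpen_ball.mem_nhds hzr)⟩
  choose u hur hux hu using hex
  have hlim : Tendsto u atTop (𝓝 x) :=
    tendsto_iff_dist_tendsto_zero.2 <| squeeze_zero (fun _ => dist_nonneg) (fun k => (hux k).le)
      tendsto_one_div_add_atTop_nhds_zero_nat
  have hb : ∀ k, fderiv ℝ f (u k) ∈ Metric.closedBall (0 : X →L[ℝ] Y) K := fun k => by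
    simpa using norm_fderiv_le_of_lipschitzOn ℝ (Metric.isOpen_ball.mem_nhds (hur k)) hK
  obtain ⟨L, -, φ, hφ, hL⟩ := tendsto_subseq_of_bounded Metric.isBounded_closedBall hb
  exact ⟨L, subset_convexHull ℝ _
    ⟨u ∘ φ, fun k => hu _, hlim.comp hφ.tendsto_atTop, hL⟩⟩

theorem IsConservativeJacobian.upperCompactOn (hJ : IsConservativeJacobian D f J) :
    UpperCompactOn D J := by
  have : ProperSpace (X →L[ℝ] Y) := FiniteDimensional.proper_real _
  exact UpperCompactOn.of_bounded_closed hJ.locallyBounded hJ.graphClosed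

/-- By upper semicontinuity, every element of `J` near `x` sends `v` close to `d`. Integrating along
short segments of direction `v` puts all nearby difference quotients within `ε` of `d`, and the
closed ball of radius `ε` then also contains `L v`. -/
theorem IsConservativeJacobian.clarkeJacobian_apply (hD : IsOpen D)
    (hJ : IsConservativeJacobian D f J) {x : X} (hx : x ∈ D) {v : X} {d : Y}
    (h : ∀ N ∈ J x, N v = d) {L : X →L[ℝ] Y} (hL : L ∈ clarkeJacobian f x) : L v = d := by
  rw [← sub_eq_zero, ← norm_le_zero_iff]
  refine le_of_forall_pos_le_add fun ε hε => ?_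
  rw [zero_add]
  have hcont : Continuous fun N : X →L[ℝ] Y => ‖N v - d‖ := by fun_prop
  have hev := hJ.upperCompactOn.eventually_mem hx (O := {N | ‖N v - d‖ < ε})
    (isOpen_lt hcont continuous_const) (fun N hN => by simpa [h N hN] using hε)
  rw [hD.nhdsWithin_eq hx] at hev
  obtain ⟨r, hr, hball⟩ := Metric.mem_nhds_iff.1 (inter_mem hev (hD.mem_nhds hx))
  rw [← mem_closedBall_iff_norm]
  refine clarkeJacobian_apply_mem Metric.isClosed_closedBall (convex_closedBall d ε) ?_ hL
  filter_upwards [Metric.ball_mem_nhds x hr] with z hz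
  have hz' : ∀ᶠ t : ℝ in 𝓝 0, z + t • v ∈ Metric.ball x r := by
    have hc : Continuous fun t : ℝ => z + t • v := by fun_prop
    exact hc.continuousAt.eventually (Metric.isOpen_ball.mem_nhds (by simpa using hz))
  filter_upwards [self_mem_nhdsWithin, nhdsWithin_le_nhds hz'] with t ht htz
  have ht0 : (0 : ℝ) < t := ht
  have hmem : ∀ s ∈ Icc (0 : ℝ) 1, z + s • t • v ∈ Metric.ball x r := by
    intro s hs
    have := (convex_ball x r).add_smul_sub_mem hz htz hs
    simpa using this
  have := hJ.norm_sub_sub_le (z := z) (w := t • v) (d := t • d) (ε := t * ε)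
    (fun s hs => (hball (hmem s hs)).2) (fun s hs N hN => by
      rw [map_smul, ← smul_sub, norm_smul, Real.norm_of_nonneg ht0.le]
      gcongr
      exact le_of_lt ((hball (hmem s hs)).1 hN))
  have heq : t⁻¹ • (f (z + t • v) - f z) - d = t⁻¹ • (f (z + t • v) - f z - t • d) := by
    rw [smul_sub _ _ (t • d), smul_smul, inv_mul_cancel₀ ht0.ne', one_smul]
  rw [mem_closedBall_iff_norm, heq, norm_smul, norm_inv, Real.norm_of_nonneg ht0.le,
    inv_mul_le_iff₀ ht0]
  exact this

/-- The Clarke Jacobian of a path differentiable function is conservative. -/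
theorem IsConservativeJacobian.clarkeJacobian (hD : IsOpen D) (hJ : IsConservativeJacobian D f J) :
    IsConservativeJacobian D f (clarkeJacobian f) := by
  refine .of_upperCompactOn hJ.locallyLipschitz
    (fun x hx => clarkeJacobian_nonempty hD hJ.locallyLipschitz hx)
    (upperCompactOn_clarkeJacobian hD hJ.locallyLipschitz) fun c hc hcD => ?_
  filter_upwards [hJ.chainRule c hc hcD, ae_restrict_mem measurableSet_Icc] with t ht htI M hM
  obtain ⟨N, hN⟩ := hJ.nonempty _ (hcD t htI)
  -- At almost every time all elements of `J (c t)` agree on the velocity, by uniqueness of the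
  -- derivative of `f ∘ c`.
  rw [hJ.clarkeJacobian_apply hD (hcD t htI) (fun N' hN' => (ht N' hN').unique (ht N hN)) hM]
  exact ht N hN

theorem PathDifferentiableOn.clarkeJacobian (hD : IsOpen D) (hf : PathDifferentiableOn D f) :
    IsConservativeJacobian D f (clarkeJacobian f) :=
  let ⟨_, hJ⟩ := hf.2
  hJ.clarkeJacobian hD

end Clarke

end DualPathDiff

/-! ### Calculus of path differentiable maps -/

namespace DualPathDiff

theorem _root_.LocallyLipschitzOn.comp_mapsTo {X Y Z : Type*} [PseudoEMetricSpace X]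
    [PseudoEMetricSpace Y] [PseudoEMetricSpace Z] {F : Y → Z} {G : X → Y} {D : Set X} {D' : Set Y}
    (hF : LocallyLipschitzOn D' F) (hG : LocallyLipschitzOn D G) (hD : MapsTo G D D') :
    LocallyLipschitzOn D fun x => F (G x) := by
  intro x hx
  obtain ⟨K, t, ht, hK⟩ := hF (hD hx)
  obtain ⟨K', t', ht', hK'⟩ := hG hx
  have hpre : G ⁻¹' t ∈ 𝓝[D] x :=
    (tendsto_nhdsWithin_iff.2 ⟨hG.continuousOn x hx, by
      filter_upwards [self_mem_nhdsWithin] with z hz using hD hz⟩) ht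
  exact ⟨K * K', t' ∩ G ⁻¹' t, inter_mem ht' hpre,
    hK.comp (hK'.mono inter_subset_left) fun z hz => hz.2⟩

theorem _root_.LocallyLipschitzOn.prodMk_on {X Y Z : Type*} [PseudoEMetricSpace X]
    [PseudoEMetricSpace Y] [PseudoEMetricSpace Z] {F : X → Y} {G : X → Z} {D : Set X}
    (hF : LocallyLipschitzOn D F) (hG : LocallyLipschitzOn D G) :
    LocallyLipschitzOn D fun x => (F x, G x) := by
  intro x hx
  obtain ⟨K, t, ht, hK⟩ := hF hx
  obtain ⟨K', t', ht', hK'⟩ := hG hx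
  exact ⟨max K K', t ∩ t', inter_mem ht ht',
    (hK.mono inter_subset_left).prodMk (hK'.mono inter_subset_right)⟩

section

variable {X Y Z : Type*} [NormedAddCommGroup X] [NormedSpace ℝ X]
  [NormedAddCommGroup Y] [NormedSpace ℝ Y] [NormedAddCommGroup Z] [NormedSpace ℝ Z]
  {D : Set X}

theorem _root_.AbsolutelyContinuousOnInterval.ae_hasDerivAt [FiniteDimensional ℝ X] {c : ℝ → X}
    (hc : AbsolutelyContinuousOnInterval c 0 1) :
    ∀ᵐ t ∂(volume.restrict (Icc (0 : ℝ) 1)), HasDerivAt c (deriv c t) t := by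
  rw [ae_restrict_iff' measurableSet_Icc]
  filter_upwards [hc.boundedVariationOn.ae_differentiableAt_of_mem_uIcc] with t ht htI
  exact (ht (by rwa [uIcc_of_le zero_le_one])).hasDerivAt

theorem PathDifferentiableOn.congr {f g : X → Y} (hf : PathDifferentiableOn D f) (h : EqOn g f D) :
    PathDifferentiableOn D g := by
  obtain ⟨hlip, J, hJ⟩ := hf
  have hlip' : LocallyLipschitzOn D g := by
    intro x hx
    obtain ⟨K, t, ht, hK⟩ := hlip hx
    refine ⟨K, t ∩ D, inter_mem ht self_mem_nhdsWithin, fun z hz w hw => ?_⟩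
    rw [h hz.2, h hw.2]
    exact hK hz.1 hw.1
  refine ⟨hlip', J, hlip', hJ.nonempty, hJ.locallyBounded, hJ.graphClosed, fun c hc hcD => ?_⟩
  -- The curve may leave `D` outside [0,1], so the endpoints are discarded: at interior times the
  -- two compositions agree on a neighbourhood.
  have hIoo : ∀ᵐ t ∂(volume.restrict (Icc (0 : ℝ) 1)), t ∈ Ioo (0 : ℝ) 1 := by
    rw [← restrict_Ioo_eq_restrict_Icc]
    exact ae_restrict_mem measurableSet_Ioo
  filter_upwards [hJ.chainRule c hc hcD, hIoo] with t ht htI M hM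
  refine (ht M hM).congr_of_eventuallyEq ?_
  filter_upwards [Ioo_mem_nhds htI.1 htI.2] with s hs
  exact h (hcD s (Ioo_subset_Icc_self hs))

variable [FiniteDimensional ℝ X]

theorem _root_.ContDiff.pathDifferentiableOn {f : X → Y} (hf : ContDiff ℝ 1 f) :
    PathDifferentiableOn D f := by
  have hlip : LocallyLipschitzOn D f := hf.locallyLipschitz.locallyLipschitzOn
  refine ⟨hlip, fun x => {fderiv ℝ f x}, .of_upperCompactOn hlip (fun _ _ => singleton_nonempty _)
    (.of_singleton (hf.continuous_fderiv one_ne_zero).continuousOn) fun c hc _ => ?_⟩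
  filter_upwards [hc.ae_hasDerivAt] with t ht M hM
  rw [mem_singleton_iff.1 hM]
  exact ((hf.differentiable one_ne_zero) (c t)).hasFDerivAt.comp_hasDerivAt t ht

variable [FiniteDimensional ℝ Y] [FiniteDimensional ℝ Z]

/-- `G ∘ c` is again absolutely continuous, so the chain rule for `F` applies along it; products of
Jacobians are conservative. -/
theorem PathDifferentiableOn.comp {D' : Set Y} {F : Y → Z} {G : X → Y}
    (hF : PathDifferentiableOn D' F) (hG : PathDifferentiableOn D G) (hD : MapsTo G D D') :
    PathDifferentiableOn D fun x => F (G x) := by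
  obtain ⟨hFl, J', hJ'⟩ := hF
  obtain ⟨hGl, J, hJ⟩ := hG
  have hlip : LocallyLipschitzOn D fun x => F (G x) := hFl.comp_mapsTo hGl hD
  refine ⟨hlip, fun x => (fun q : (Y →L[ℝ] Z) × (X →L[ℝ] Y) => q.1 ∘L q.2) '' (J' (G x) ×ˢ J x),
    .of_upperCompactOn hlip (fun x hx => ?_) ?_ fun c hc hcD => ?_⟩
  · exact ((hJ'.nonempty _ (hD hx)).prod (hJ.nonempty x hx)).image _
  · refine ((hJ'.upperCompactOn.comp hGl.continuousOn hD).prod hJ.upperCompactOn).image ?_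
    intro x _ a _
    apply Continuous.continuousAt
    fun_prop
  · have hGc := hGl.comp_absolutelyContinuousOnInterval hc
      (by rw [uIcc_of_le zero_le_one]; exact hcD)
    filter_upwards [hJ.chainRule c hc hcD, hJ'.chainRule _ hGc fun t ht => hD (hcD t ht)]
      with t h1 h2
    rintro _ ⟨⟨M, N⟩, ⟨hM, hN⟩, rfl⟩
    have := h2 M hM
    rw [(h1 N hN).deriv] at this
    exact this

theorem PathDifferentiableOn.prodMk {F : X → Y} {G : X → Z} (hF : PathDifferentiableOn D F)
    (hG : PathDifferentiableOn D G) : PathDifferentiableOn D fun x => (F x, G x) := by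
  obtain ⟨hFl, J', hJ'⟩ := hF
  obtain ⟨hGl, J, hJ⟩ := hG
  have hlip : LocallyLipschitzOn D fun x => (F x, G x) := hFl.prodMk_on hGl
  refine ⟨hlip, fun x => (fun q : (X →L[ℝ] Y) × (X →L[ℝ] Z) => q.1.prod q.2) '' (J' x ×ˢ J x),
    .of_upperCompactOn hlip (fun x hx => ?_) ?_ fun c hc hcD => ?_⟩
  · exact ((hJ'.nonempty x hx).prod (hJ.nonempty x hx)).image _
  · refine (hJ'.upperCompactOn.prod hJ.upperCompactOn).image ?_
    intro x _ a _
    exact (ContinuousLinearMap.prodₗᵢ ℝ : _ ≃ₗᵢ[ℝ] (X →L[ℝ] Y × Z)).continuous.continuousAt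
  · filter_upwards [hJ.chainRule c hc hcD, hJ'.chainRule c hc hcD] with t h1 h2
    rintro _ ⟨⟨M, N⟩, ⟨hM, hN⟩, rfl⟩
    exact (h2 M hM).prodMk (h1 N hN)

end

end DualPathDiff

/-! ### Smooth strongly convex functions and their conjugates -/

namespace DualPathDiff

section Gradient

variable {X : Type*} [NormedAddCommGroup X] [InnerProductSpace ℝ X] [CompleteSpace X]
  {f : X → ℝ} {α β : ℝ}

theorem _root_.DifferentiableAt.tendsto_slope_gradient {x : X} (hf : DifferentiableAt ℝ f x)
    (v : X) :
    Tendsto (fun t : ℝ => t⁻¹ * (f (x + t • v) - f x)) (𝓝[>] 0) (𝓝 (inner ℝ (gradient f x) v)) := by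
  have h := (hf.hasFDerivAt.hasLineDerivAt v).tendsto_slope_zero_right
  simpa [gradient] using h

theorem _root_.StrongConvexOn.add_inner_gradient_le (hc : StrongConvexOn univ α f) {x : X}
    (hf : DifferentiableAt ℝ f x) (z : X) :
    f x + inner ℝ (gradient f x) (z - x) + α / 2 * ‖z - x‖ ^ 2 ≤ f z := by
  have hlim : Tendsto (fun t : ℝ => f z - f x - (1 - t) * (α / 2 * ‖z - x‖ ^ 2)) (𝓝[>] 0)
      (𝓝 (f z - f x - (1 - 0) * (α / 2 * ‖z - x‖ ^ 2))) := by
    apply Tendsto.mono_left _ nhdsWithin_le_nhds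
    apply Continuous.tendsto
    fun_prop
  have := le_of_tendsto_of_tendsto (hf.tendsto_slope_gradient (z - x)) hlim ?_
  · linarith
  · filter_upwards [Ioo_mem_nhdsGT (zero_lt_one (α := ℝ))] with t ht
    have h1 := hc.2 (mem_univ x) (mem_univ z) (sub_nonneg.2 ht.2.le) ht.1.le (by ring)
    have h2 : (1 - t) • x + t • z = x + t • (z - x) := by module
    rw [h2, norm_sub_rev x z] at h1
    simp only [smul_eq_mul] at h1
    rw [inv_mul_le_iff₀ ht.1]
    linarith

/-- The descent lemma. -/
theorem HasLipschitzGradient.le_add_inner (hf : HasLipschitzGradient β f) (x z : X) :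
    f z ≤ f x + inner ℝ (gradient f x) (z - x) + β / 2 * ‖z - x‖ ^ 2 := by
  -- The gap between `f` on the segment and its quadratic upper model has nonpositive derivative on
  -- (0,1); its values at 0 and 1 are then compared.
  have hderiv : ∀ t : ℝ, HasDerivAt
      (fun t : ℝ => f (x + t • (z - x)) - t * inner ℝ (gradient f x) (z - x) -
        β / 2 * ‖z - x‖ ^ 2 * t ^ 2)
      (inner ℝ (gradient f (x + t • (z - x))) (z - x) - 1 * inner ℝ (gradient f x) (z - x) -
        β / 2 * ‖z - x‖ ^ 2 * (2 * t)) t := by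
    intro t
    have hl : HasDerivAt (fun s : ℝ => x + s • (z - x)) ((1 : ℝ) • (z - x)) t :=
      ((hasDerivAt_id t).smul_const _).const_add x
    have hfl := ((hf.1 (x + t • (z - x))).hasFDerivAt).comp_hasDerivAt t hl
    have heq : fderiv ℝ f (x + t • (z - x)) ((1 : ℝ) • (z - x)) =
        inner ℝ (gradient f (x + t • (z - x))) (z - x) := by simp [gradient]
    rw [heq] at hfl
    refine (hfl.sub ((hasDerivAt_id t).mul_const _)).sub ?_
    simpa using ((hasDerivAt_id t).pow 2).const_mul (β / 2 * ‖z - x‖ ^ 2)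
  have hanti := antitoneOn_of_deriv_nonpos (convex_Icc (0 : ℝ) 1)
    (fun t _ => (hderiv t).continuousAt.continuousWithinAt)
    (fun t _ => (hderiv t).differentiableAt.differentiableWithinAt) (fun t ht => ?_)
  · have := hanti (left_mem_Icc.2 zero_le_one) (right_mem_Icc.2 zero_le_one) zero_le_one
    simp only [one_smul, zero_smul, add_sub_cancel, add_zero] at this
    linarith
  · rw [(hderiv t).deriv]
    rw [interior_Icc] at ht
    have h1 : inner ℝ (gradient f (x + t • (z - x)) - gradient f x) (z - x) ≤
        β * (t * ‖z - x‖) * ‖z - x‖ := by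
      refine (real_inner_le_norm _ _).trans ?_
      gcongr
      refine (hf.2 _ _).trans (le_of_eq ?_)
      rw [add_sub_cancel_left, norm_smul, Real.norm_of_nonneg ht.1.le]
    rw [inner_sub_left] at h1
    nlinarith

end Gradient

section Conj

variable {X : Type*} [NormedAddCommGroup X] [InnerProductSpace ℝ X] {f : X → ℝ} {α β : ℝ}

/-- Both lower bounds are taken at the base point `w = a • x + b • z`; in their weighted sum the
linear terms cancel. -/
theorem strongConvexOn_of_add_inner_le {s : X → X}
    (h : ∀ x z, f x + inner ℝ (s x) (z - x) + α / 2 * ‖z - x‖ ^ 2 ≤ f z) :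
    StrongConvexOn univ α f := by
  refine ⟨convex_univ, fun x _ z _ a b ha hb hab => ?_⟩
  set w := a • x + b • z with hw
  have hx := h w x
  have hz := h w z
  have hxw : x - w = b • (x - z) := by
    rw [hw, ← sub_eq_zero]
    have : x = (a + b) • x := by rw [hab, one_smul]
    nth_rw 1 [this]
    module
  have hzw : z - w = -(a • (x - z)) := by
    rw [hw, ← sub_eq_zero]
    have : z = (a + b) • z := by rw [hab, one_smul]
    nth_rw 1 [this]
    module
  rw [hxw, inner_smul_right, norm_smul, Real.norm_of_nonneg hb] at hx
  rw [hzw, inner_neg_right, inner_smul_right, norm_neg, norm_smul, Real.norm_of_nonneg ha] at hz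
  simp only [smul_eq_mul]
  have hx' := mul_le_mul_of_nonneg_left hx ha
  have hz' := mul_le_mul_of_nonneg_left hz hb
  have hb' : b = 1 - a := by linarith
  subst hb'
  nlinarith

theorem conjE_eq_of_forall_le {x u : X} (h : ∀ z, inner ℝ z u - f z ≤ inner ℝ x u - f x) :
    conjE f u = ((inner ℝ x u - f x : ℝ) : EReal) := by
  apply le_antisymm
  · refine iSup_le fun z => ?_
    rw [← EReal.coe_sub]
    exact_mod_cast h z
  · refine le_trans ?_ (le_iSup _ x)
    rw [EReal.coe_sub]

variable [FiniteDimensional ℝ X]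

/-- Strong convexity makes `f - ⟨u, ·⟩` coercive, and its gradient vanishes at a minimizer. -/
theorem exists_gradient_eq (hα : 0 < α) (hc : StrongConvexOn univ α f) (hf : Differentiable ℝ f)
    (u : X) : ∃ x, gradient f x = u := by
  have hcoer : Tendsto (fun z => f z - inner ℝ u z) (cocompact X) atTop := by
    have hq : Tendsto (fun z : X => ‖z‖ * (α / 2 * ‖z‖ - ‖gradient f 0 - u‖) + f 0)
        (cocompact X) atTop := by
      refine tendsto_atTop_add_const_right _ _ ?_
      refine Tendsto.atTop_mul_atTop₀ (tendsto_norm_cocompact_atTop) ?_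
      refine tendsto_atTop_add_const_right _ _ ?_
      exact tendsto_norm_cocompact_atTop.const_mul_atTop (by positivity)
    refine tendsto_atTop_mono (fun z => ?_) hq
    have h1 := hc.add_inner_gradient_le (hf 0) z
    have h2 := abs_le.1 (abs_real_inner_le_norm (gradient f 0 - u) z)
    rw [inner_sub_left] at h2
    rw [sub_zero] at h1
    nlinarith [h2.1]
  obtain ⟨x, hx⟩ := (hf.continuous.sub (continuous_const.inner continuous_id) :
    Continuous fun z => f z - inner ℝ u z).exists_forall_le hcoer
  refine ⟨x, ?_⟩
  have hmin : IsLocalMin (fun z => f z - inner ℝ u z) x := Eventually.of_forall hx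
  have hd : HasFDerivAt (fun z => f z - inner ℝ u z) (fderiv ℝ f x - innerSL ℝ u) x :=
    (hf x).hasFDerivAt.sub (innerSL ℝ u).hasFDerivAt
  have h0 := hmin.hasFDerivAt_eq_zero hd
  rw [gradient, sub_eq_zero.1 h0]
  exact (InnerProductSpace.toDual ℝ X).symm_apply_apply u

/-- Properties of the conjugate of a smooth strongly convex function. -/
theorem exists_gradient_conj (hα : 0 < α) (hβ : 0 < β) (hc : StrongConvexOn univ α f)
    (hf : HasLipschitzGradient β f) :
    ∃ ψ : X → X, (∀ u, conjE f u = (conjR f u : EReal)) ∧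
      (∀ u, HasGradientAt (conjR f) (ψ u) u) ∧
      (∀ u v, ‖ψ u - ψ v‖ ≤ α⁻¹ * ‖u - v‖) ∧
      ∀ u v, conjR f u + inner ℝ (ψ u) (v - u) + β⁻¹ / 2 * ‖v - u‖ ^ 2 ≤ conjR f v := by
  -- `ψ` inverts the gradient of `f`; `ψ u` attains the supremum defining the conjugate at `u`.
  choose ψ hψ using exists_gradient_eq hα hc hf.1
  have hval : ∀ u, conjE f u = ((inner ℝ (ψ u) u - f (ψ u) : ℝ) : EReal) := fun u => by
    apply conjE_eq_of_forall_le
    intro z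
    have := hc.add_inner_gradient_le (hf.1 (ψ u)) z
    rw [hψ, inner_sub_right, real_inner_comm z u, real_inner_comm (ψ u) u] at this
    have : 0 ≤ α / 2 * ‖z - ψ u‖ ^ 2 := by positivity
    linarith
  have hR : ∀ u, conjR f u = inner ℝ (ψ u) u - f (ψ u) := fun u => by
    rw [conjR, hval, EReal.toReal_coe]
  have hsup : ∀ u z, inner ℝ z u - f z ≤ conjR f u := by
    intro u z
    have : ((inner ℝ z u - f z : ℝ) : EReal) ≤ conjE f u := by
      rw [EReal.coe_sub]
      exact le_iSup (fun x => ((inner ℝ x u : ℝ) : EReal) - (f x : EReal)) z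
    rw [hval, ← hR] at this
    exact_mod_cast this
  have hlip : ∀ u v, ‖ψ u - ψ v‖ ≤ α⁻¹ * ‖u - v‖ := by
    intro u v
    have h1 := hc.add_inner_gradient_le (hf.1 (ψ u)) (ψ v)
    have h2 := hc.add_inner_gradient_le (hf.1 (ψ v)) (ψ u)
    rw [hψ] at h1 h2
    have h3 : α * ‖ψ u - ψ v‖ ^ 2 ≤ inner ℝ (u - v) (ψ u - ψ v) := by
      rw [norm_sub_rev (ψ v)] at h1
      have : inner ℝ u (ψ v - ψ u) = -inner ℝ u (ψ u - ψ v) := by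
        rw [← inner_neg_right, neg_sub]
      rw [inner_sub_left]
      linarith
    have h4 := h3.trans (real_inner_le_norm _ _)
    rw [le_inv_mul_iff₀ hα]
    rcases (norm_nonneg (ψ u - ψ v)).eq_or_lt with h | h
    · rw [← h, mul_zero]
      exact norm_nonneg _
    · refine le_of_mul_le_mul_right ?_ h
      linarith
  have hlow : ∀ u v, conjR f u + inner ℝ (ψ u) (v - u) ≤ conjR f v := by
    intro u v
    have := hsup v (ψ u)
    rw [hR u, inner_sub_right]
    linarith
  refine ⟨ψ, fun u => by rw [hR, hval], fun u => ?_, hlip, fun u v => ?_⟩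
  -- The first-order remainder lies between 0 and ⟨ψ v - ψ u, v - u⟩, which is at most α⁻¹‖v - u‖².
  · rw [hasGradientAt_iff_isLittleO, Asymptotics.isLittleO_iff]
    intro ε hε
    filter_upwards [Metric.ball_mem_nhds u (by positivity : 0 < α * ε)] with v hv
    have h1 := hlow u v
    have h2 := hlow v u
    have h3 : conjR f v - conjR f u - inner ℝ (ψ u) (v - u) ≤ inner ℝ (ψ v - ψ u) (v - u) := by
      have : inner ℝ (ψ v) (u - v) = -inner ℝ (ψ v) (v - u) := by
        rw [← inner_neg_right, neg_sub]
      rw [inner_sub_left]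
      linarith
    rw [Real.norm_of_nonneg (by linarith)]
    refine h3.trans ((real_inner_le_norm _ _).trans ?_)
    gcongr
    refine (hlip v u).trans ?_
    rw [inv_mul_le_iff₀ hα]
    rw [mem_ball_iff_norm] at hv
    exact hv.le
  -- This test point maximizes the lower bound on ⟨z, v⟩ - f z given by the descent lemma at `ψ u`.
  · set z := ψ u + β⁻¹ • (v - u) with hz
    have h1 := hsup v z
    have h2 := hf.le_add_inner (ψ u) z
    have hzu : z - ψ u = β⁻¹ • (v - u) := by rw [hz, add_sub_cancel_left]
    rw [hψ, hzu, inner_smul_right, norm_smul, Real.norm_of_nonneg (inv_nonneg.2 hβ.le)] at h2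
    have h3 : inner ℝ z v = inner ℝ (ψ u) v + β⁻¹ * inner ℝ (v - u) v := by
      rw [hz, inner_add_left, real_inner_smul_left]
    have h4 : inner ℝ (v - u) v = inner ℝ u (v - u) + ‖v - u‖ ^ 2 := by
      rw [← real_inner_self_eq_norm_sq, inner_sub_right (v - u) v u, real_inner_comm u (v - u)]
      ring
    rw [h3, h4] at h1
    rw [hR u, inner_sub_right]
    have h5 : β / 2 * (β⁻¹ * ‖v - u‖) ^ 2 = β⁻¹ / 2 * ‖v - u‖ ^ 2 := by
      field_simp
    rw [h5] at h2
    nlinarith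

end Conj

/-! ### Singular value bounds for the adjoint -/

section SingularValues

open Module ContinuousLinearMap

variable {n m : ℕ}

/-- In an orthonormal eigenbasis of K K*, ‖K* y‖² is the sum of μ_j⟨b_j, y⟩². Surjectivity makes K*
b_j nonzero, hence an eigenvector of K* K for the same μ_j, so μ_j is the square of a positive
singular value. -/
theorem sq_norm_adjoint_mem_of_singularValues (K : E n →L[ℝ] E m) (hK : Function.Surjective K)
    {lo hi : ℝ} (hlo : 0 < lo)
    (hs : ∀ i < m, (K : E n →ₗ[ℝ] E m).singularValues i ∈ Icc lo hi) (y : E m) :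
    ‖adjoint K y‖ ^ 2 ∈ Icc (lo ^ 2 * ‖y‖ ^ 2) (hi ^ 2 * ‖y‖ ^ 2) := by
  set T := (K : E n →ₗ[ℝ] E m) with hT
  have hadj : ∀ z, LinearMap.adjoint T z = adjoint K z := fun z => rfl
  have hsym : (T ∘ₗ LinearMap.adjoint T).IsSymmetric := by
    intro a b
    simp only [LinearMap.comp_apply]
    rw [← LinearMap.adjoint_inner_right, LinearMap.adjoint_inner_left]
  have hfr : finrank ℝ (E m) = m := finrank_euclideanSpace_fin
  let b := hsym.eigenvectorBasis hfr
  have hrange : finrank ℝ T.range = m := by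
    rw [LinearMap.range_eq_top.2 hK, finrank_top, hfr]
  have hμ : ∀ j, hsym.eigenvalues hfr j ∈ Icc (lo ^ 2) (hi ^ 2) := by
    intro j
    set μ := hsym.eigenvalues hfr j with hμ
    have hbj : T (LinearMap.adjoint T (b j)) = μ • b j := 
      hsym.apply_eigenvectorBasis hfr j
    have hne : b j ≠ 0 := b.toBasis.ne_zero j ∘ fun h => by simpa using h
    have hμ0 : μ = ‖LinearMap.adjoint T (b j)‖ ^ 2 := by
      have h1 : inner ℝ (T (LinearMap.adjoint T (b j))) (b j) = μ := by
        rw [hbj, real_inner_smul_left, real_inner_self_eq_norm_sq, b.norm_eq_one]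
        ring
      rw [← h1, ← real_inner_self_eq_norm_sq, LinearMap.adjoint_inner_right]
    have hA : LinearMap.adjoint T (b j) ≠ 0 := by
      intro h
      obtain ⟨x, hx⟩ := hK (b j)
      have h2 : inner ℝ (LinearMap.adjoint T (b j)) x = 0 := by rw [h, inner_zero_left]
      rw [LinearMap.adjoint_inner_left] at h2
      have hx' : T x = b j := hx
      rw [hx', real_inner_self_eq_norm_sq, b.norm_eq_one] at h2
      norm_num at h2
    have heig : End.HasEigenvalue (LinearMap.adjoint T ∘ₗ T) μ := by
      refine End.hasEigenvalue_of_hasEigenvector (x := LinearMap.adjoint T (b j)) ⟨?_, hA⟩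
      rw [End.mem_eigenspace_iff, LinearMap.comp_apply, hbj, map_smul]
    obtain ⟨i, hi'⟩ := T.isSymmetric_adjoint_comp_self.exists_eigenvalues_eq rfl heig
    have hi'' : T.singularValues i ^ 2 = μ := by
      rw [T.sq_singularValues_fin rfl i]
      simpa using hi'
    have hpos : 0 < T.singularValues i := by
      refine (T.singularValues_nonneg i).lt_of_ne ?_
      intro h
      rw [← h] at hi''
      have : 0 < μ := by rw [hμ0]; positivity
      simp [← hi''] at this
    -- Positive singular values are those with index below the rank, here `m`; only these are
    -- controlled by `hs`.
    have hlt : (i : ℕ) < m := by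
      rw [← hrange]
      exact T.singularValues_pos_iff_lt_finrank_range.1 hpos
    obtain ⟨h1, h2⟩ := hs i hlt
    rw [← hi'']
    constructor <;> gcongr
  have hexp : ‖adjoint K y‖ ^ 2 = ∑ j, hsym.eigenvalues hfr j * (inner ℝ (b j) y) ^ 2 := by
    rw [← real_inner_self_eq_norm_sq, ← hadj, LinearMap.adjoint_inner_right]
    rw [← b.sum_inner_mul_inner]
    refine Finset.sum_congr rfl fun j _ => ?_
    have h1 : inner ℝ (T (LinearMap.adjoint T y)) (b j) =
        hsym.eigenvalues hfr j * inner ℝ (b j) y := by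
      have h2 := hsym y (b j)
      have h3 : (T ∘ₗ LinearMap.adjoint T) (b j) = hsym.eigenvalues hfr j • b j := 
        hsym.apply_eigenvectorBasis hfr j
      rw [h3, inner_smul_right, real_inner_comm] at h2
      rw [real_inner_comm y (b j), ← h2, real_inner_comm]
      rfl
    rw [h1]
    ring
  have hnorm : ‖y‖ ^ 2 = ∑ j, (inner ℝ (b j) y) ^ 2 := by
    rw [← b.sum_sq_norm_inner_right y]
    simp
  rw [hexp, hnorm, Finset.mul_sum, Finset.mul_sum]
  constructor <;> refine Finset.sum_le_sum fun j _ => ?_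
  · exact mul_le_mul_of_nonneg_right (hμ j).1 (sq_nonneg _)
  · exact mul_le_mul_of_nonneg_right (hμ j).2 (sq_nonneg _)

end SingularValues

end DualPathDiff

/-! ### Extended-valued convex functions and proximal maps -/

namespace DualPathDiff

section Extended

variable {X : Type*} [NormedAddCommGroup X] [InnerProductSpace ℝ X] {h : X → EReal}

theorem IsClosedConvexProper.exists_eq_coe (hh : IsClosedConvexProper h) {x : X} (hx : h x ≠ ⊤) :
    ∃ r : ℝ, h x = r :=
  ⟨(h x).toReal, (EReal.coe_toReal hx (hh.ne_bot x)).symm⟩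

/-- A closed convex proper function has an affine minorant. -/
theorem IsClosedConvexProper.exists_affine_le [CompleteSpace X] (hh : IsClosedConvexProper h) :
    ∃ (s : X) (c : ℝ), ∀ w, ((inner ℝ s w + c : ℝ) : EReal) ≤ h w := by
  obtain ⟨x, hx⟩ := hh.exists_ne_top
  obtain ⟨r, hr⟩ := hh.exists_eq_coe hx
  have hclosed : IsClosed {q : X × ℝ | h q.1 ≤ (q.2 : EReal)} :=
    hh.closed.isClosed_epigraph.preimage
      (continuous_fst.prodMk (continuous_coe_real_ereal.comp continuous_snd))
  -- The point one unit below the graph is separated strictly from the closed convex epigraph.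
  have hnot : (x, r - 1) ∉ {q : X × ℝ | h q.1 ≤ (q.2 : EReal)} := by
    simp only [mem_ofPred_eq, hr, not_le]
    exact_mod_cast sub_one_lt r
  obtain ⟨ℓ, κ, h1, h2⟩ := geometric_hahn_banach_point_closed hh.convex hclosed hnot
  have hℓ : ∀ w t, ℓ (w, t) = ℓ (w, 0) + t * ℓ (0, 1) := by
    intro w t
    have : ((w, t) : X × ℝ) = (w, 0) + t • (0, 1) := by simp
    rw [this, map_add, map_smul, smul_eq_mul]
  -- Comparing (x, r - 1) with (x, r) shows that the hyperplane is not vertical.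
  have hc : 0 < ℓ (0, 1) := by
    have h3 := h2 (x, r) hr.le
    rw [hℓ] at h1 h3
    linarith
  set a := (InnerProductSpace.toDual ℝ X).symm (ℓ ∘L ContinuousLinearMap.inl ℝ X ℝ) with ha
  have haw : ∀ w, inner ℝ a w = ℓ (w, 0) := fun w => by
    rw [ha, InnerProductSpace.toDual_symm_apply]
    simp
  refine ⟨-((ℓ (0, 1))⁻¹ • a), (ℓ (0, 1))⁻¹ * κ, fun w => ?_⟩
  by_cases hw : h w = ⊤
  · rw [hw]
    exact le_top
  obtain ⟨s, hs⟩ := hh.exists_eq_coe hw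
  have h3 := h2 (w, s) hs.le
  rw [hℓ, ← haw] at h3
  rw [hs, EReal.coe_le_coe_iff, inner_neg_left, real_inner_smul_left]
  have h4 : -((ℓ (0, 1))⁻¹ * inner ℝ a w) + (ℓ (0, 1))⁻¹ * κ =
      (ℓ (0, 1))⁻¹ * (κ - inner ℝ a w) := by ring
  rw [h4, inv_mul_le_iff₀ hc]
  linarith

/-- Points where `h` is infinite contribute -∞ to the supremum and drop out, leaving real
inequalities. -/
theorem IsClosedConvexProper.conj_le_coe_iff (hh : IsClosedConvexProper h) {u : X} {s : ℝ} :
    conj h u ≤ s ↔ ∀ (x : X) (r : ℝ), h x = r → inner ℝ x u - r ≤ s := by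
  rw [conj, iSup_le_iff]
  refine forall_congr' fun x => ⟨fun hx r hr => ?_, fun hx => ?_⟩
  · rw [hr, ← EReal.coe_sub] at hx
    exact_mod_cast hx
  · by_cases ht : h x = ⊤
    · simp [ht]
    · obtain ⟨r, hr⟩ := hh.exists_eq_coe ht
      rw [hr, ← EReal.coe_sub]
      exact_mod_cast hx r hr

theorem IsClosedConvexProper.conj [CompleteSpace X] (hh : IsClosedConvexProper h) :
    IsClosedConvexProper (conj h) where
  closed := by
    refine lowerSemicontinuous_iSup fun x => ?_
    by_cases ht : h x = ⊤
    · simpa [ht] using lowerSemicontinuous_const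
    · obtain ⟨r, hr⟩ := hh.exists_eq_coe ht
      simp_rw [hr, ← EReal.coe_sub]
      apply Continuous.lowerSemicontinuous
      apply continuous_coe_real_ereal.comp
      fun_prop
  convex := by
    rintro ⟨u, s⟩ hu ⟨v, t⟩ hv a b ha hb hab
    simp only [mem_ofPred_eq, Prod.smul_mk, Prod.mk_add_mk, hh.conj_le_coe_iff] at hu hv ⊢
    intro x r hr
    rw [inner_add_right, inner_smul_right, inner_smul_right, smul_eq_mul, smul_eq_mul]
    have hrab : r = a * r + b * r := by rw [← add_mul, hab, one_mul]
    have h1 := mul_le_mul_of_nonneg_left (hu x r hr) ha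
    have h2 := mul_le_mul_of_nonneg_left (hv x r hr) hb
    linarith
  ne_bot := by
    intro u
    obtain ⟨x, hx⟩ := hh.exists_ne_top
    obtain ⟨r, hr⟩ := hh.exists_eq_coe hx
    refine ne_bot_of_le_ne_bot (EReal.coe_ne_bot (inner ℝ x u - r)) ?_
    rw [EReal.coe_sub, ← hr]
    exact le_iSup (fun x => ((inner ℝ x u : ℝ) : EReal) - h x) x
  exists_ne_top := by
    -- The slope of an affine minorant is a point where the conjugate is finite.
    obtain ⟨s, c, hs⟩ := hh.exists_affine_le
    refine ⟨s, ((hh.conj_le_coe_iff (s := -c)).2 fun x r hr => ?_).trans_lt (EReal.coe_lt_top _) |>.ne⟩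
    have := hs x
    rw [hr, EReal.coe_le_coe_iff, real_inner_comm] at this
    linarith

theorem IsClosedConvexProper.const_mul (hh : IsClosedConvexProper h) {γ : ℝ} (hγ : 0 < γ) :
    IsClosedConvexProper fun u => (γ : EReal) * h u where
  closed := by
    have hcont : Continuous fun z : EReal => (γ : EReal) * z := by
      refine continuous_iff_continuousAt.2 fun z => ?_
      have hγ0 : (γ : EReal) ≠ 0 := by exact_mod_cast hγ.ne'
      have hp : ContinuousAt (fun p : EReal × EReal => p.1 * p.2) ((γ : EReal), z) :=
        EReal.continuousAt_mul (Or.inl hγ0) (Or.inl hγ0) (Or.inl (EReal.coe_ne_bot _))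
          (Or.inl (EReal.coe_ne_top _))
      exact hp.comp (f := fun z : EReal => ((γ : EReal), z)) (by fun_prop)
    exact hcont.comp_lowerSemicontinuous hh.closed fun a b hab =>
      mul_le_mul_of_nonneg_left hab (by exact_mod_cast hγ.le)
  convex := by
    have hiff : ∀ (x : X) (s : ℝ), (γ : EReal) * h x ≤ s ↔ h x ≤ ((γ⁻¹ * s : ℝ) : EReal) := by
      intro x s
      by_cases ht : h x = ⊤
      · simp only [ht, EReal.coe_mul_top_of_pos hγ, top_le_iff, EReal.coe_ne_top]
      · obtain ⟨r, hr⟩ := hh.exists_eq_coe ht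
        rw [hr, ← EReal.coe_mul, EReal.coe_le_coe_iff, EReal.coe_le_coe_iff, le_inv_mul_iff₀ hγ]
    rintro ⟨u, s⟩ hu ⟨v, t⟩ hv a b ha hb hab
    simp only [mem_ofPred_eq, hiff] at hu hv ⊢
    have := hh.convex (x := (u, γ⁻¹ * s)) hu (y := (v, γ⁻¹ * t)) hv ha hb hab
    simp only [mem_ofPred_eq, Prod.smul_mk, Prod.mk_add_mk, smul_eq_mul] at this ⊢
    convert this using 3
    ring
  ne_bot := by
    intro u hu
    by_cases ht : h u = ⊤
    · simp [ht, EReal.coe_mul_top_of_pos hγ] at hu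
    · obtain ⟨r, hr⟩ := hh.exists_eq_coe ht
      rw [hr, ← EReal.coe_mul] at hu
      exact EReal.coe_ne_bot _ hu
  exists_ne_top := by
    obtain ⟨x, hx⟩ := hh.exists_ne_top
    obtain ⟨r, hr⟩ := hh.exists_eq_coe hx
    exact ⟨x, by rw [hr, ← EReal.coe_mul]; exact EReal.coe_ne_top _⟩

/-- `s` is a subgradient of `h` at `u`, where `h` is finite. -/
def IsSubgradient (h : X → EReal) (u s : X) : Prop :=
  ∃ r : ℝ, h u = r ∧ ∀ w, ((r + inner ℝ s (w - u) : ℝ) : EReal) ≤ h w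

theorem IsSubgradient.inner_nonneg {u s u' s' : X} (hs : IsSubgradient h u s)
    (hs' : IsSubgradient h u' s') : 0 ≤ inner ℝ (s - s') (u - u') := by
  obtain ⟨r, hr, hw⟩ := hs
  obtain ⟨r', hr', hw'⟩ := hs'
  have h1 := hw u'
  have h2 := hw' u
  rw [hr', EReal.coe_le_coe_iff, ← neg_sub u u', inner_neg_right] at h1
  rw [hr, EReal.coe_le_coe_iff] at h2
  rw [inner_sub_left]
  linarith

theorem IsSubgradient.const_mul {u s : X} (hs : IsSubgradient h u s) {γ : ℝ} (hγ : 0 < γ) :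
    IsSubgradient (fun w => (γ : EReal) * h w) u (γ • s) := by
  obtain ⟨r, hr, hw⟩ := hs
  refine ⟨γ * r, by simp only [hr, EReal.coe_mul], fun w => ?_⟩
  rw [real_inner_smul_left, ← mul_add, EReal.coe_mul]
  exact mul_le_mul_of_nonneg_left (hw w) (by exact_mod_cast hγ.le)

/-- On the segment from `u` to `w`, convexity bounds `h` by its chord, so minimality bounds the
slope of `ψ` from below by `h u - h w`. Convexity of `ψ` plays no role. -/
theorem IsClosedConvexProper.isSubgradient_of_minimizer [CompleteSpace X]
    (hh : IsClosedConvexProper h) {ψ : X → ℝ} {u : X} (hψ : DifferentiableAt ℝ ψ u)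
    (hmin : ∀ w, h u + (ψ u : EReal) ≤ h w + (ψ w : EReal)) :
    IsSubgradient h u (-gradient ψ u) := by
  have hu : h u ≠ ⊤ := by
    intro ht
    obtain ⟨x, hx⟩ := hh.exists_ne_top
    obtain ⟨r, hr⟩ := hh.exists_eq_coe hx
    have := hmin x
    rw [ht, EReal.top_add_coe, hr, ← EReal.coe_add, top_le_iff] at this
    exact EReal.coe_ne_top _ this
  obtain ⟨r, hr⟩ := hh.exists_eq_coe hu
  refine ⟨r, hr, fun w => ?_⟩
  by_cases hw : h w = ⊤
  · rw [hw]
    exact le_top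
  obtain ⟨s, hs⟩ := hh.exists_eq_coe hw
  rw [hs, EReal.coe_le_coe_iff, inner_neg_left]
  have hlim := hψ.tendsto_slope_gradient (w - u)
  have := ge_of_tendsto hlim (b := r - s) ?_
  · linarith
  filter_upwards [Ioo_mem_nhdsGT (zero_lt_one (α := ℝ))] with t ht
  have h1 := hh.convex (x := (u, r)) hr.le (y := (w, s)) hs.le (sub_nonneg.2 ht.2.le) ht.1.le
    (by ring : (1 - t) + t = 1)
  have h2 : (1 - t) • u + t • w = u + t • (w - u) := by module
  simp only [mem_ofPred_eq, Prod.smul_mk, Prod.mk_add_mk, smul_eq_mul, h2] at h1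
  have h3 := hmin (u + t • (w - u))
  have h4 := h3.trans (add_le_add_left h1 _)
  rw [hr, ← EReal.coe_add, ← EReal.coe_add, EReal.coe_le_coe_iff] at h4
  rw [le_inv_mul_iff₀ ht.1]
  linarith

variable [FiniteDimensional ℝ X]

/-- An affine minorant of `h` plus the quadratic minorant of `ψ` makes the sum coercive; lower
semicontinuity on a large ball does the rest. -/
theorem IsClosedConvexProper.exists_minimizer (hh : IsClosedConvexProper h) {ψ : X → ℝ}
    (hψ : Continuous ψ) {κ c : ℝ} {s : X} (hκ : 0 < κ)
    (hlow : ∀ w, κ * ‖w‖ ^ 2 + inner ℝ s w + c ≤ ψ w) :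
    ∃ u, ∀ w, h u + (ψ u : EReal) ≤ h w + (ψ w : EReal) := by
  obtain ⟨s', c', hs'⟩ := hh.exists_affine_le
  obtain ⟨x, hx⟩ := hh.exists_ne_top
  obtain ⟨r, hr⟩ := hh.exists_eq_coe hx
  have hlim : Tendsto (fun t : ℝ => t * (κ * t - ‖s + s'‖) + (c + c')) atTop atTop := by
    refine tendsto_atTop_add_const_right _ _ (tendsto_id.atTop_mul_atTop₀ ?_)
    exact tendsto_atTop_add_const_right _ _ (tendsto_id.const_mul_atTop hκ)
  obtain ⟨ρ, hρ⟩ := (hlim.eventually_gt_atTop (r + ψ x)).exists_forall_of_atTop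
  have hlsc : LowerSemicontinuous fun w => h w + (ψ w : EReal) := by
    refine hh.closed.add' (continuous_coe_real_ereal.comp hψ).lowerSemicontinuous fun w => ?_
    exact EReal.continuousAt_add (Or.inr (EReal.coe_ne_bot _)) (Or.inr (EReal.coe_ne_top _))
  have hxball : x ∈ Metric.closedBall (0 : X) (max ρ ‖x‖) := by simp
  obtain ⟨u, -, hu⟩ := (hlsc.lowerSemicontinuousOn _).exists_isMinOn ⟨x, hxball⟩
    (isCompact_closedBall (0 : X) (max ρ ‖x‖))
  refine ⟨u, fun w => ?_⟩
  by_cases hw : w ∈ Metric.closedBall (0 : X) (max ρ ‖x‖)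
  · exact hu hw
  · refine (hu hxball).trans ?_
    have hwρ : ρ ≤ ‖w‖ := by
      rw [mem_closedBall_zero_iff, not_le] at hw
      exact (le_max_left _ _).trans hw.le
    have h1 : r + ψ x ≤ (inner ℝ s' w + c') + ψ w := by
      have h2 := hρ _ hwρ
      have h3 := hlow w
      have h4 := (abs_le.1 (abs_real_inner_le_norm (s + s') w)).1
      rw [inner_add_left] at h4
      nlinarith
    calc h x + (ψ x : EReal) = ((r + ψ x : ℝ) : EReal) := by rw [hr, EReal.coe_add]
      _ ≤ (((inner ℝ s' w + c') + ψ w : ℝ) : EReal) := by exact_mod_cast h1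
      _ ≤ h w + (ψ w : EReal) := by
        rw [EReal.coe_add]
        exact add_le_add_left (hs' w) _

theorem IsClosedConvexProper.isSubgradient_prox (hh : IsClosedConvexProper h) (x : X) :
    IsSubgradient h (prox h x) (x - prox h x) := by
  have hgrad : ∀ u, HasGradientAt (fun w => ‖x - w‖ ^ 2 / 2) (u - x) u := by
    intro u
    rw [hasGradientAt_iff_hasFDerivAt]
    have h1 : HasFDerivAt (fun w => x - w) (-ContinuousLinearMap.id ℝ X) u :=
      (hasFDerivAt_id u).const_sub x
    have h2 := (h1.norm_sq).mul_const (2⁻¹ : ℝ)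
    simp only [← div_eq_mul_inv] at h2
    refine h2.congr_fderiv ?_
    ext v
    simp
  -- The choice made in `prox` is a minimizer only once one is known to exist.
  have hex : ∃ u, ∀ w, h u + ((‖x - u‖ ^ 2 / 2 : ℝ) : EReal) ≤
      h w + ((‖x - w‖ ^ 2 / 2 : ℝ) : EReal) := by
    refine hh.exists_minimizer (ψ := fun w => ‖x - w‖ ^ 2 / 2) (κ := 1 / 2) (s := -x)
      (c := ‖x‖ ^ 2 / 2) (by fun_prop) (by norm_num) fun w => ?_
    rw [norm_sub_sq_real, inner_neg_left]
    linarith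
  have := hh.isSubgradient_of_minimizer (hgrad (prox h x)).differentiableAt
    (Classical.epsilon_spec hex)
  rwa [(hgrad _).gradient, neg_sub] at this

/-- The proximal operator is firmly nonexpansive. -/
theorem IsClosedConvexProper.norm_prox_sub_prox_sq_le (hh : IsClosedConvexProper h) (x y : X) :
    ‖prox h x - prox h y‖ ^ 2 ≤ inner ℝ (x - y) (prox h x - prox h y) := by
  have h1 := (hh.isSubgradient_prox x).inner_nonneg (hh.isSubgradient_prox y)
  have h2 : x - prox h x - (y - prox h y) = (x - y) - (prox h x - prox h y) := by abel
  rw [h2, inner_sub_left, real_inner_self_eq_norm_sq] at h1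
  linarith

theorem IsClosedConvexProper.prox_eq_of_isSubgradient (hh : IsClosedConvexProper h) {x u : X}
    (hu : IsSubgradient h u (x - u)) : prox h x = u := by
  have h1 := hu.inner_nonneg (hh.isSubgradient_prox x)
  have h2 : x - u - (x - prox h x) = -(u - prox h x) := by abel
  rw [h2, inner_neg_left, real_inner_self_eq_norm_sq] at h1
  have h3 : ‖u - prox h x‖ ^ 2 = 0 := le_antisymm (by linarith) (sq_nonneg _)
  rw [sq_eq_zero_iff, norm_eq_zero, sub_eq_zero] at h3
  exact h3.symm

end Extended

end DualPathDiff

/-! ### Implicit differentiation of the fixed point equation -/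

namespace DualPathDiff

section Implicit

variable {p m : ℕ} {Θ : Set (E p)} {T B : E p × E m → E m} {γ a b : ℝ} {ystar : E p → E m}

/-- The condition ‖w‖² ≤ ⟨v, w⟩ describes the closed ball of centre v/2 and radius ‖v‖/2. Being
closed and convex, it passes from difference quotients to the Clarke Jacobian. -/
theorem norm_sq_le_inner_of_mem_clarkeJacobian (hΘ : IsOpen Θ)
    (hT : ∀ θ ∈ Θ, ∀ x y, ‖T (θ, x) - T (θ, y)‖ ^ 2 ≤ inner ℝ (x - y) (T (θ, x) - T (θ, y)))
    {q : E p × E m} (hq : q.1 ∈ Θ) {L : E p × E m →L[ℝ] E m} (hL : L ∈ clarkeJacobian T q)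
    (v : E m) : ‖L (0, v)‖ ^ 2 ≤ inner ℝ v (L (0, v)) := by
  have hiff : ∀ w : E m, w ∈ Metric.closedBall ((2⁻¹ : ℝ) • v) (2⁻¹ * ‖v‖) ↔
      ‖w‖ ^ 2 ≤ inner ℝ v w := by
    intro w
    rw [mem_closedBall_iff_norm, ← sq_le_sq₀ (norm_nonneg _) (by positivity), norm_sub_sq_real,
      norm_smul, inner_smul_right, real_inner_comm, mul_pow, mul_pow, Real.norm_of_nonneg
      (by norm_num)]
    constructor <;> intro h <;> linarith
  rw [← hiff]
  refine clarkeJacobian_apply_mem Metric.isClosed_closedBall (convex_closedBall _ _) ?_ hL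
  filter_upwards [(hΘ.preimage continuous_fst).mem_nhds hq] with z hz
  filter_upwards [self_mem_nhdsWithin] with t ht
  have ht0 : (0 : ℝ) < t := ht
  rw [hiff]
  have h1 := hT z.1 hz (z.2 + t • v) z.2
  have h2 : z + t • ((0 : E p), v) = (z.1, z.2 + t • v) := by ext <;> simp
  rw [h2]
  rw [add_sub_cancel_left, real_inner_smul_left] at h1
  rw [norm_smul, inner_smul_right, mul_pow, norm_inv, Real.norm_of_nonneg ht0.le, sq t⁻¹, mul_assoc]
  gcongr
  rw [inv_mul_le_iff₀ ht0]
  exact h1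

theorem le_inner_of_mem_clarkeJacobian (hΘ : IsOpen Θ)
    (hB : ∀ θ ∈ Θ, ∀ x y, a * ‖x - y‖ ^ 2 ≤ inner ℝ (x - y) (B (θ, x) - B (θ, y)))
    {q : E p × E m} (hq : q.1 ∈ Θ) {L : E p × E m →L[ℝ] E m} (hL : L ∈ clarkeJacobian B q)
    (v : E m) : a * ‖v‖ ^ 2 ≤ inner ℝ v (L (0, v)) := by
  refine clarkeJacobian_apply_mem (C := {w | a * ‖v‖ ^ 2 ≤ inner ℝ v w})
    (isClosed_le continuous_const (by fun_prop))
    (convex_halfSpace_ge (innerₗ (E m) v).isLinear _) ?_ hL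
  filter_upwards [(hΘ.preimage continuous_fst).mem_nhds hq] with z hz
  filter_upwards [self_mem_nhdsWithin] with t ht
  have ht0 : (0 : ℝ) < t := ht
  have h1 := hB z.1 hz (z.2 + t • v) z.2
  have h2 : z + t • ((0 : E p), v) = (z.1, z.2 + t • v) := by ext <;> simp
  rw [h2]
  change _ ≤ inner ℝ v _
  rw [inner_smul_right, le_inv_mul_iff₀ ht0]
  rw [add_sub_cancel_left, real_inner_smul_left, norm_smul, Real.norm_of_nonneg ht0.le] at h1
  refine le_of_mul_le_mul_left ?_ ht0
  linarith

/-- A kernel vector satisfies v = V(v - γ Z v); `hV` then gives γ⟨v, Z v⟩ ≤ 0, and `hZ` forces v =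
0. In finite dimension injectivity suffices. -/
theorem isInvertible_id_sub_comp {V Z : E m →L[ℝ] E m} (hγ : 0 < γ) (ha : 0 < a)
    (hV : ∀ w, ‖V w‖ ^ 2 ≤ inner ℝ w (V w)) (hZ : ∀ v, a * ‖v‖ ^ 2 ≤ inner ℝ v (Z v)) :
    (ContinuousLinearMap.id ℝ (E m) -
      V ∘L (ContinuousLinearMap.id ℝ (E m) - γ • Z)).IsInvertible := by
  set A := ContinuousLinearMap.id ℝ (E m) - V ∘L (ContinuousLinearMap.id ℝ (E m) - γ • Z) with hA
  have hinj : Function.Injective A.toLinearMap := by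
    rw [← LinearMap.ker_eq_bot, LinearMap.ker_eq_bot']
    intro v hv
    have hv' : v - V (v - γ • Z v) = 0 := hv
    have h1 := hV (v - γ • Z v)
    rw [← sub_eq_zero.1 hv', inner_sub_left, real_inner_smul_left, real_inner_self_eq_norm_sq,
      real_inner_comm] at h1
    have h2 := hZ v
    have h3 : γ * (a * ‖v‖ ^ 2) ≤ 0 := by
      have := mul_le_mul_of_nonneg_left h2 hγ.le
      linarith
    have h4 : ‖v‖ ^ 2 ≤ 0 := by
      by_contra! h
      exact absurd h3 (not_le.2 (by positivity))
    simpa using le_antisymm h4 (sq_nonneg _)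
  refine ⟨(LinearEquiv.ofInjectiveEndo A.toLinearMap hinj).toContinuousLinearEquiv, ?_⟩
  ext1 v
  rfl

/-- Error bound by the residual e. With d = y₁ - y₂ and g = G y₁ - G y₂, firm nonexpansiveness
reduces to 0 ≤ ⟨e - γ g, d - e⟩; expanding gives γ⟨d, g⟩ ≤ ⟨e, d⟩ + γ⟨g, e⟩, and ‖d‖ is divided out.
-/
theorem mul_norm_sub_le_of_fixedPoint {S G : E m → E m} {y₁ y₂ : E m} (hγ : 0 < γ) (hb : 0 ≤ b)
    (hS : ∀ x y, ‖S x - S y‖ ^ 2 ≤ inner ℝ (x - y) (S x - S y))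
    (hGmono : ∀ x y, a * ‖x - y‖ ^ 2 ≤ inner ℝ (x - y) (G x - G y))
    (hGlip : ∀ x y, ‖G x - G y‖ ≤ b * ‖x - y‖) (hy : S (y₁ - γ • G y₁) = y₁) :
    γ * a * ‖y₁ - y₂‖ ≤ (1 + γ * b) * ‖S (y₂ - γ • G y₂) - y₂‖ := by
  set e := S (y₂ - γ • G y₂) - y₂ with he
  have h1 := hS (y₁ - γ • G y₁) (y₂ - γ • G y₂)
  have h2 : S (y₁ - γ • G y₁) - S (y₂ - γ • G y₂) = (y₁ - y₂) - e := by
    rw [hy, he]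
    abel
  have h3 : y₁ - γ • G y₁ - (y₂ - γ • G y₂) = (y₁ - y₂ - e) + (e - γ • (G y₁ - G y₂)) := by
    rw [smul_sub]
    abel
  have hx : ∀ d g : E m, inner ℝ (e - γ • g) (d - e) =
      inner ℝ e d - ‖e‖ ^ 2 - γ * inner ℝ d g + γ * inner ℝ g e := fun d g => by
    rw [inner_sub_left, inner_sub_right, real_inner_self_eq_norm_sq, real_inner_smul_left,
      inner_sub_right, real_inner_comm d g]
    ring
  rw [h2, h3, inner_add_left, real_inner_self_eq_norm_sq, hx] at h1
  have h4 := hGmono y₁ y₂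
  have h5 := real_inner_le_norm e (y₁ - y₂)
  have h6 : inner ℝ (G y₁ - G y₂) e ≤ b * ‖y₁ - y₂‖ * ‖e‖ :=
    (real_inner_le_norm _ _).trans (by gcongr; exact hGlip _ _)
  have h7 : γ * (a * ‖y₁ - y₂‖ ^ 2) ≤ γ * inner ℝ (y₁ - y₂) (G y₁ - G y₂) := by gcongr
  have h8 : γ * inner ℝ (G y₁ - G y₂) e ≤ γ * (b * ‖y₁ - y₂‖ * ‖e‖) := by gcongr
  have h9 : (γ * a * ‖y₁ - y₂‖) * ‖y₁ - y₂‖ ≤ ((1 + γ * b) * ‖e‖) * ‖y₁ - y₂‖ := by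
    nlinarith [sq_nonneg ‖e‖]
  rcases (norm_nonneg (y₁ - y₂)).eq_or_lt with h | h
  · rw [← h, mul_zero]
    positivity
  · exact le_of_mul_le_mul_right h9 h

theorem locallyLipschitzOn_of_fixedPoint (hΘ : IsOpen Θ) (hγ : 0 < γ) (ha : 0 < a) (hb : 0 ≤ b)
    (hT : ∀ θ ∈ Θ, ∀ x y, ‖T (θ, x) - T (θ, y)‖ ^ 2 ≤ inner ℝ (x - y) (T (θ, x) - T (θ, y)))
    (hBmono : ∀ θ ∈ Θ, ∀ x y, a * ‖x - y‖ ^ 2 ≤ inner ℝ (x - y) (B (θ, x) - B (θ, y)))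
    (hBlip : ∀ θ ∈ Θ, ∀ x y, ‖B (θ, x) - B (θ, y)‖ ≤ b * ‖x - y‖)
    (hG : LocallyLipschitzOn (Θ ×ˢ univ)
      fun q : E p × E m => T (q.1, q.2 - γ • B q))
    (hy : ∀ θ ∈ Θ, T (θ, ystar θ - γ • B (θ, ystar θ)) = ystar θ) :
    LocallyLipschitzOn Θ ystar := by
  -- The error bound at parameter `θ₁`, tested at `ystar θ₂`: the residual is then a variation in
  -- the parameter alone.
  have key : ∀ θ₁ ∈ Θ, ∀ θ₂ ∈ Θ, ‖ystar θ₁ - ystar θ₂‖ ≤ (γ * a)⁻¹ * (1 + γ * b) *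
      ‖T (θ₁, ystar θ₂ - γ • B (θ₁, ystar θ₂)) - T (θ₂, ystar θ₂ - γ • B (θ₂, ystar θ₂))‖ := by
    intro θ₁ h₁ θ₂ h₂
    rw [mul_assoc, le_inv_mul_iff₀ (by positivity), hy θ₂ h₂]
    exact mul_norm_sub_le_of_fixedPoint (S := fun x => T (θ₁, x)) (G := fun x => B (θ₁, x)) hγ hb
      (hT θ₁ h₁) (hBmono θ₁ h₁) (hBlip θ₁ h₁) (hy θ₁ h₁)
  intro θ₀ h₀
  obtain ⟨r, hr, k, hrD, hk⟩ := hG.exists_ball (x := (θ₀, ystar θ₀)) (hΘ.prod isOpen_univ)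
    ⟨h₀, mem_univ _⟩
  set C : NNReal := ⟨(γ * a)⁻¹ * (1 + γ * b), by positivity⟩ with hC
  have hCval : (C : ℝ) = (γ * a)⁻¹ * (1 + γ * b) := rfl
  have hmem : ∀ {θ : E p} {y : E m}, θ ∈ Metric.ball θ₀ r → y ∈ Metric.ball (ystar θ₀) r →
      (θ, y) ∈ Metric.ball (θ₀, ystar θ₀) r := fun h1 h2 => by
    rw [← ball_prod_same]
    exact ⟨h1, h2⟩
  have hsubΘ : ∀ {θ : E p}, θ ∈ Metric.ball θ₀ r → θ ∈ Θ := fun h =>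
    (hrD (hmem h (Metric.mem_ball_self hr))).1
  have hstep : ∀ {θ₁ θ₂ : E p}, θ₁ ∈ Metric.ball θ₀ r → θ₂ ∈ Metric.ball θ₀ r →
      ystar θ₂ ∈ Metric.ball (ystar θ₀) r →
      dist (ystar θ₁) (ystar θ₂) ≤ (C * k : NNReal) * dist θ₁ θ₂ := by
    intro θ₁ θ₂ h₁ h₂ h
    rw [dist_eq_norm, NNReal.coe_mul, mul_assoc]
    refine (key θ₁ (hsubΘ h₁) θ₂ (hsubΘ h₂)).trans ?_
    rw [← hCval]
    gcongr
    have := hk.dist_le_mul _ (hmem h₁ h) _ (hmem h₂ h)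
    rw [dist_eq_norm] at this
    refine this.trans (le_of_eq ?_)
    rw [Prod.dist_eq, dist_self, max_eq_left dist_nonneg]
  -- `hstep` needs `ystar θ₂` near `ystar θ₀`. Applied first with second argument `θ₀`, where this
  -- is automatic, it keeps the solution within `r` on this smaller ball; the `+ 1` guards against
  -- division by zero.
  have hδ : 0 < min r (r / ((C * k : NNReal) + 1)) := lt_min hr (by positivity)
  refine ⟨C * k, Metric.ball θ₀ (min r (r / ((C * k : NNReal) + 1))),
    mem_nhdsWithin_of_mem_nhds (Metric.ball_mem_nhds _ hδ),
    LipschitzOnWith.of_dist_le_mul fun θ₁ h₁ θ₂ h₂ => ?_⟩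
  have h₁' := Metric.ball_subset_ball (min_le_left _ _) h₁
  have h₂' := Metric.ball_subset_ball (min_le_left _ _) h₂
  refine hstep h₁' h₂' ?_
  rw [Metric.mem_ball]
  refine (hstep h₂' (Metric.mem_ball_self hr) (Metric.mem_ball_self hr)).trans_lt ?_
  have h3 : dist θ₂ θ₀ < r / ((C * k : NNReal) + 1) := (Metric.mem_ball.1 h₂).trans_le
    (min_le_right _ _)
  rw [lt_div_iff₀ (by positivity)] at h3
  nlinarith [dist_nonneg (x := θ₂) (y := θ₀)]

/-- The matrix `(I - V (I - γ Z))⁻¹ (U - γ V W)` as a function of `[U V]` and `[W Z]`. -/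
noncomputable def implicitMap (γ : ℝ)
    (q : (E p × E m →L[ℝ] E m) × (E p × E m →L[ℝ] E m)) : E p →L[ℝ] E m :=
  (ContinuousLinearMap.inverse
    (ContinuousLinearMap.id ℝ (E m) - (q.1 ∘L ContinuousLinearMap.inr ℝ (E p) (E m)) ∘L
      (ContinuousLinearMap.id ℝ (E m) - γ • (q.2 ∘L ContinuousLinearMap.inr ℝ (E p) (E m))))) ∘L
    (q.1 ∘L ContinuousLinearMap.inl ℝ (E p) (E m) -
      γ • ((q.1 ∘L ContinuousLinearMap.inr ℝ (E p) (E m)) ∘L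
        (q.2 ∘L ContinuousLinearMap.inl ℝ (E p) (E m))))

theorem implicitJacobian_eq_image (J₁ J₂ : Set (E p × E m →L[ℝ] E m)) :
    implicitJacobian γ J₁ J₂ = implicitMap γ '' (J₁ ×ˢ J₂) := by
  ext M
  constructor
  · rintro ⟨U, W, V, Z, h1, h2, rfl⟩
    refine ⟨(U.coprod V, W.coprod Z), ⟨h1, h2⟩, ?_⟩
    simp [implicitMap]
  · rintro ⟨⟨L₁, L₂⟩, ⟨h1, h2⟩, rfl⟩
    refine ⟨L₁ ∘L .inl ℝ _ _, L₂ ∘L .inl ℝ _ _, L₁ ∘L .inr ℝ _ _, L₂ ∘L .inr ℝ _ _, ?_, ?_, rfl⟩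
    · rwa [ContinuousLinearMap.coprod_comp_inl_inr]
    · rwa [ContinuousLinearMap.coprod_comp_inl_inr]

theorem continuousAt_implicitMap {q : (E p × E m →L[ℝ] E m) × (E p × E m →L[ℝ] E m)}
    (hq : (ContinuousLinearMap.id ℝ (E m) - (q.1 ∘L ContinuousLinearMap.inr ℝ (E p) (E m)) ∘L
      (ContinuousLinearMap.id ℝ (E m) -
        γ • (q.2 ∘L ContinuousLinearMap.inr ℝ (E p) (E m)))).IsInvertible) :
    ContinuousAt (implicitMap γ) q := by
  have h1 : ContinuousAt (fun q : (E p × E m →L[ℝ] E m) × (E p × E m →L[ℝ] E m) =>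
      ContinuousLinearMap.id ℝ (E m) - (q.1 ∘L ContinuousLinearMap.inr ℝ (E p) (E m)) ∘L
      (ContinuousLinearMap.id ℝ (E m) -
        γ • (q.2 ∘L ContinuousLinearMap.inr ℝ (E p) (E m)))) q := by
    apply Continuous.continuousAt
    fun_prop
  have h2 := ContinuousAt.comp' (f := fun q : (E p × E m →L[ℝ] E m) × (E p × E m →L[ℝ] E m) =>
      ContinuousLinearMap.id ℝ (E m) - (q.1 ∘L ContinuousLinearMap.inr ℝ (E p) (E m)) ∘L
      (ContinuousLinearMap.id ℝ (E m) -
        γ • (q.2 ∘L ContinuousLinearMap.inr ℝ (E p) (E m))))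
    (hq.contDiffAt_map_inverse (𝕜 := ℝ) (n := 0)).continuousAt h1
  have h3 : ContinuousAt (fun q : (E p × E m →L[ℝ] E m) × (E p × E m →L[ℝ] E m) =>
      q.1 ∘L ContinuousLinearMap.inl ℝ (E p) (E m) -
      γ • ((q.1 ∘L ContinuousLinearMap.inr ℝ (E p) (E m)) ∘L
        (q.2 ∘L ContinuousLinearMap.inl ℝ (E p) (E m)))) q := by
    apply Continuous.continuousAt
    fun_prop
  exact h2.clm_comp h3

theorem coprod_inl_inr_apply (L : E p × E m →L[ℝ] E m) (x : E p) (y : E m) :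
    L (x, y) = L (x, 0) + L (0, y) := by
  rw [← map_add]
  simp

/-- The hypothesis `h` is the differentiated fixed point equation; grouping its terms in `y` gives
(I - V(I - γ Z)) y = (U - γ V W) x. -/
theorem implicitMap_apply_eq {L₁ L₂ : E p × E m →L[ℝ] E m} {x : E p} {y : E m}
    (hinv : (ContinuousLinearMap.id ℝ (E m) -
      (L₁ ∘L ContinuousLinearMap.inr ℝ (E p) (E m)) ∘L (ContinuousLinearMap.id ℝ (E m) -
        γ • (L₂ ∘L ContinuousLinearMap.inr ℝ (E p) (E m)))).IsInvertible)
    (h : L₁ (x, y - γ • L₂ (x, y)) = y) : implicitMap γ (L₁, L₂) x = y := by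
  set A := ContinuousLinearMap.id ℝ (E m) -
    (L₁ ∘L ContinuousLinearMap.inr ℝ (E p) (E m)) ∘L
    (ContinuousLinearMap.id ℝ (E m) - γ • (L₂ ∘L ContinuousLinearMap.inr ℝ (E p) (E m))) with hA
  have hAy : A y = L₁ (x, 0) - γ • L₁ (0, L₂ (x, 0)) := by
    have h9 : ((0 : E p), y - γ • L₂ (x, y)) =
        (0, y - γ • L₂ (0, y)) - γ • (0, L₂ (x, 0)) := by
      rw [coprod_inl_inr_apply L₂ x y]
      ext1
      · simp
      · simp only [Prod.snd_sub, Prod.smul_snd]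
        module
    rw [coprod_inl_inr_apply, h9, map_sub, map_smul] at h
    have hAy' : A y = y - L₁ (0, y - γ • L₂ (0, y)) := rfl
    rw [hAy']
    nth_rw 1 [← h]
    abel
  have h10 : implicitMap γ (L₁, L₂) x = A.inverse (L₁ (x, 0) - γ • L₁ (0, L₂ (x, 0))) := rfl
  rw [h10, ← hAy]
  obtain ⟨e, he⟩ := hinv
  rw [← he, ContinuousLinearMap.inverse_equiv]
  exact e.symm_apply_apply y

theorem _root_.LocallyLipschitzOn.prodMk_sub_smul {D : Set (E p × E m)}
    (hB : LocallyLipschitzOn D B) (γ : ℝ) :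
    LocallyLipschitzOn D fun q : E p × E m => (q.1, q.2 - γ • B q) := by
  have h1 : ContDiff ℝ 1 fun q : (E p × E m) × E m => (q.1.1, q.1.2 - γ • q.2) := by fun_prop
  have h2 : LocallyLipschitzOn D fun q : E p × E m => q :=
    LipschitzWith.id.locallyLipschitz.locallyLipschitzOn
  have h3 : LocallyLipschitzOn univ fun q : (E p × E m) × E m => (q.1.1, q.1.2 - γ • q.2) :=
    h1.locallyLipschitz.locallyLipschitzOn
  exact LocallyLipschitzOn.comp_mapsTo (G := fun q => (q, B q)) h3 (h2.prodMk_on hB)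
    (mapsTo_univ _ _)

/-- The solution of the fixed point equation `y = T(θ, y - γ B(θ, y))` is path differentiable, with
the Jacobian given by implicit differentiation. -/
theorem isConservativeJacobian_of_fixedPoint (hΘ : IsOpen Θ) (hγ : 0 < γ) (ha : 0 < a) (hb : 0 ≤ b)
    (hTpd : PathDifferentiableOn (Θ ×ˢ univ) T) (hBpd : PathDifferentiableOn (Θ ×ˢ univ) B)
    (hT : ∀ θ ∈ Θ, ∀ x y, ‖T (θ, x) - T (θ, y)‖ ^ 2 ≤ inner ℝ (x - y) (T (θ, x) - T (θ, y)))
    (hBmono : ∀ θ ∈ Θ, ∀ x y, a * ‖x - y‖ ^ 2 ≤ inner ℝ (x - y) (B (θ, x) - B (θ, y)))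
    (hBlip : ∀ θ ∈ Θ, ∀ x y, ‖B (θ, x) - B (θ, y)‖ ≤ b * ‖x - y‖)
    (hy : ∀ θ ∈ Θ, T (θ, ystar θ - γ • B (θ, ystar θ)) = ystar θ) :
    IsConservativeJacobian Θ ystar fun θ => implicitJacobian γ
      (clarkeJacobian T (θ, ystar θ - γ • B (θ, ystar θ))) (clarkeJacobian B (θ, ystar θ)) := by
  have hD : IsOpen (Θ ×ˢ (univ : Set (E m))) := hΘ.prod isOpen_univ
  have hTJ := hTpd.clarkeJacobian hD
  have hBJ := hBpd.clarkeJacobian hD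
  have hstep := hBpd.1.prodMk_sub_smul γ
  have hlip : LocallyLipschitzOn Θ ystar :=
    locallyLipschitzOn_of_fixedPoint hΘ hγ ha hb hT hBmono hBlip
      (LocallyLipschitzOn.comp_mapsTo (G := fun q : E p × E m => (q.1, q.2 - γ • B q)) hTpd.1
        hstep fun q hq => ⟨hq.1, mem_univ _⟩) hy
  have hid : LocallyLipschitzOn Θ fun θ : E p => θ :=
    LipschitzWith.id.locallyLipschitz.locallyLipschitzOn
  have hq : LocallyLipschitzOn Θ fun θ => (θ, ystar θ) := hid.prodMk_on hlip
  have hqD : MapsTo (fun θ => (θ, ystar θ)) Θ (Θ ×ˢ univ) := fun θ hθ => ⟨hθ, mem_univ _⟩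
  have hr : LocallyLipschitzOn Θ fun θ => (θ, ystar θ - γ • B (θ, ystar θ)) :=
    LocallyLipschitzOn.comp_mapsTo (G := fun θ => (θ, ystar θ)) hstep hq hqD
  have hrD : MapsTo (fun θ => (θ, ystar θ - γ • B (θ, ystar θ))) Θ (Θ ×ˢ univ) :=
    fun θ hθ => ⟨hθ, mem_univ _⟩
  have hinv : ∀ θ ∈ Θ, ∀ L₁ ∈ clarkeJacobian T (θ, ystar θ - γ • B (θ, ystar θ)),
      ∀ L₂ ∈ clarkeJacobian B (θ, ystar θ),
      (ContinuousLinearMap.id ℝ (E m) - (L₁ ∘L ContinuousLinearMap.inr ℝ (E p) (E m)) ∘L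
      (ContinuousLinearMap.id ℝ (E m) -
        γ • (L₂ ∘L ContinuousLinearMap.inr ℝ (E p) (E m)))).IsInvertible := by
    intro θ hθ L₁ h₁ L₂ h₂
    exact isInvertible_id_sub_comp hγ ha
      (norm_sq_le_inner_of_mem_clarkeJacobian hΘ hT (q := (_, _)) hθ h₁)
      (le_inner_of_mem_clarkeJacobian hΘ hBmono (q := (_, _)) hθ h₂)
  simp_rw [implicitJacobian_eq_image]
  refine .of_upperCompactOn hlip (fun θ hθ => ?_) ?_ fun c hc hcD => ?_
  · exact ((hTJ.nonempty _ (hrD hθ)).prod (hBJ.nonempty _ (hqD hθ))).image _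
  · refine ((hTJ.upperCompactOn.comp hr.continuousOn hrD).prod
      (hBJ.upperCompactOn.comp hq.continuousOn hqD)).image ?_
    rintro θ hθ ⟨L₁, L₂⟩ ⟨h₁, h₂⟩
    exact continuousAt_implicitMap (hinv θ hθ L₁ h₁ L₂ h₂)
  · have hcm : MapsTo c (uIcc 0 1) Θ := by
      rw [uIcc_of_le zero_le_one]
      exact hcD
    have hIoo : ∀ᵐ t ∂(volume.restrict (Icc (0 : ℝ) 1)), t ∈ Ioo (0 : ℝ) 1 := by
      rw [← restrict_Ioo_eq_restrict_Icc]
      exact ae_restrict_mem measurableSet_Ioo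
    filter_upwards [hIoo, hc.ae_hasDerivAt,
      (hlip.comp_absolutelyContinuousOnInterval hc hcm).ae_hasDerivAt,
      hBJ.chainRule _ (hq.comp_absolutelyContinuousOnInterval hc hcm) fun t ht => hqD (hcD t ht),
      hTJ.chainRule _ (hr.comp_absolutelyContinuousOnInterval hc hcm) fun t ht => hrD (hcD t ht)]
      with t htI h1 h2 h3 h4
    rintro _ ⟨⟨L₁, L₂⟩, ⟨hL₁, hL₂⟩, rfl⟩
    set c' := deriv c t
    set y' := deriv (fun s => ystar (c s)) t
    have h5 := h3 L₂ hL₂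
    rw [(h1.prodMk h2).deriv] at h5
    have h6 := h4 L₁ hL₁
    have hr' : HasDerivAt (fun s => (c s, ystar (c s) - γ • B (c s, ystar (c s))))
        (c', y' - γ • L₂ (c', y')) t := h1.prodMk (h2.sub (h5.const_smul γ))
    rw [hr'.deriv] at h6
    have h7 : HasDerivAt (fun s => ystar (c s)) (L₁ (c', y' - γ • L₂ (c', y'))) t := by
      refine h6.congr_of_eventuallyEq ?_
      filter_upwards [Ioo_mem_nhds htI.1 htI.2] with s hs
      exact (hy _ (hcD s (Ioo_subset_Icc_self hs))).symm
    -- Two expressions for the derivative of the same curve: the linearized fixed point equation.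
    have h8 : L₁ (c', y' - γ • L₂ (c', y')) = y' := h7.unique h2
    rw [implicitMap_apply_eq (hinv _ (hcD t (Ioo_subset_Icc_self htI)) L₁ hL₁ L₂ hL₂) h8]
    exact h2

end Implicit

end DualPathDiff

/-! ### The dual problem -/

namespace DualPathDiff

theorem IsConservativeJacobian.congr_set {X Y : Type*} [NormedAddCommGroup X] [NormedSpace ℝ X]
    [NormedAddCommGroup Y] [NormedSpace ℝ Y] {D : Set X} {f : X → Y} {J J' : X → Set (X →L[ℝ] Y)}
    (hJ : IsConservativeJacobian D f J) (h : ∀ x ∈ D, J' x = J x) :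
    IsConservativeJacobian D f J' where
  locallyLipschitz := hJ.locallyLipschitz
  nonempty x hx := by rw [h x hx]; exact hJ.nonempty x hx
  locallyBounded x hx := by
    obtain ⟨C, hC⟩ := hJ.locallyBounded x hx
    refine ⟨C, ?_⟩
    filter_upwards [hC, self_mem_nhdsWithin] with z hz hzD
    rwa [h z hzD]
  graphClosed x hx M hM := by
    have hset : {q : X × (X →L[ℝ] Y) | q.1 ∈ D ∧ q.2 ∈ J' q.1} =
        {q | q.1 ∈ D ∧ q.2 ∈ J q.1} := by
      ext q
      exact and_congr_right fun hq => by rw [h _ hq]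
    rw [h x hx]
    exact hJ.graphClosed x hx M (hset ▸ hM)
  chainRule c hc hcD := by
    filter_upwards [hJ.chainRule c hc hcD, ae_restrict_mem measurableSet_Icc] with t ht htI
    rwa [h _ (hcD t htI)]

section Dual

open ContinuousLinearMap

variable {p n m : ℕ} {α β lo hi : ℝ}

/-- Regularity of the smooth part of the dual objective. -/
theorem dualSmooth_regularity {f : E n → ℝ} {K : E n →L[ℝ] E m} (hα : 0 < α) (hβ : 0 < β)
    (hlo : 0 < lo) (hlohi : lo ≤ hi) (hc : StrongConvexOn univ α f)
    (hf : HasLipschitzGradient β f) (hK : Function.Surjective K)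
    (hs : ∀ i < m, (K : E n →ₗ[ℝ] E m).singularValues i ∈ Icc lo hi) :
    (∀ y, dualSmoothE f K y = (dualSmooth f K y : EReal)) ∧
      (∀ y, HasGradientAt (dualSmooth f K) (-K (gradient (conjR f) (-adjoint K y))) y) ∧
      (∀ x z, dualSmooth f K x + inner ℝ (gradient (dualSmooth f K) x) (z - x) +
        lo ^ 2 / β / 2 * ‖z - x‖ ^ 2 ≤ dualSmooth f K z) ∧
      HasLipschitzGradient (hi ^ 2 / α) (dualSmooth f K) := by
  obtain ⟨ψ, hval, hgrad, hlip, hlow⟩ := exists_gradient_conj hα hβ hc hf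
  have hadj := sq_norm_adjoint_mem_of_singularValues K hK hlo hs
  have hψ : gradient (conjR f) = ψ := funext fun u => (hgrad u).gradient
  have hG : ∀ y, HasGradientAt (dualSmooth f K) (-K (ψ (-adjoint K y))) y := by
    intro y
    rw [hasGradientAt_iff_hasFDerivAt]
    have h1 : HasFDerivAt (fun y => -adjoint K y) (-adjoint K) y := (adjoint K).hasFDerivAt.neg
    have h2 := (hgrad (-adjoint K y)).hasFDerivAt.comp y h1
    refine h2.congr_fderiv ?_
    ext v
    simp [adjoint_inner_right]
  have hhi : 0 ≤ hi := hlo.le.trans hlohi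
  have hnorm : ∀ y, ‖adjoint K y‖ ≤ hi * ‖y‖ := fun y => by
    rw [← sq_le_sq₀ (norm_nonneg _) (by positivity), mul_pow]
    exact (hadj y).2
  -- K and its adjoint have equal norm; each contributes one factor `hi` to the Lipschitz constant.
  have hKnorm : ∀ x, ‖K x‖ ≤ hi * ‖x‖ := by
    have h1 : ‖K‖ ≤ hi := by
      rw [← LinearIsometryEquiv.norm_map adjoint K]
      exact opNorm_le_bound _ hhi hnorm
    exact fun x => (K.le_opNorm x).trans (by gcongr)
  rw [hψ]
  refine ⟨fun y => hval _, hG, fun x z => ?_, fun x => (hG x).differentiableAt, fun x z => ?_⟩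
  · have h1 := hlow (-adjoint K x) (-adjoint K z)
    have h2 : -adjoint K z - -adjoint K x = -adjoint K (z - x) := by
      rw [map_sub]
      abel
    rw [h2, inner_neg_right, adjoint_inner_right, norm_neg] at h1
    rw [(hG x).gradient, inner_neg_left]
    have h3 := (hadj (z - x)).1
    have h4 : lo ^ 2 / β / 2 * ‖z - x‖ ^ 2 ≤ β⁻¹ / 2 * ‖adjoint K (z - x)‖ ^ 2 := by
      have h5 : lo ^ 2 / β / 2 * ‖z - x‖ ^ 2 = β⁻¹ / 2 * (lo ^ 2 * ‖z - x‖ ^ 2) := by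
        rw [div_eq_mul_inv]
        ring
      rw [h5]
      gcongr
    have h6 : dualSmooth f K x = conjR f (-adjoint K x) := rfl
    have h7 : dualSmooth f K z = conjR f (-adjoint K z) := rfl
    rw [h6, h7]
    linarith
  · rw [(hG x).gradient, (hG z).gradient, ← neg_sub', norm_neg, ← map_sub]
    calc ‖K (ψ (-adjoint K x) - ψ (-adjoint K z))‖
        ≤ hi * (α⁻¹ * ‖-adjoint K x - -adjoint K z‖) := by
          refine (hKnorm _).trans ?_
          gcongr
          exact hlip _ _
      _ ≤ hi * (α⁻¹ * (hi * ‖x - z‖)) := by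
          gcongr
          rw [← neg_sub', norm_neg, ← map_sub]
          exact hnorm _
      _ = hi ^ 2 / α * ‖x - z‖ := by
          rw [div_eq_mul_inv]
          ring

theorem inner_gradient_sub_ge {X : Type*} [NormedAddCommGroup X] [InnerProductSpace ℝ X]
    [CompleteSpace X] {D : X → ℝ} {a : ℝ}
    (h : ∀ x z, D x + inner ℝ (gradient D x) (z - x) + a / 2 * ‖z - x‖ ^ 2 ≤ D z) (x y : X) :
    a * ‖x - y‖ ^ 2 ≤ inner ℝ (x - y) (gradient D x - gradient D y) := by
  have h1 := h x y
  have h2 := h y x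
  rw [← neg_sub x y, inner_neg_right, norm_neg] at h1
  rw [real_inner_comm, inner_sub_left]
  linarith

/-- A strongly convex smooth function plus a closed convex proper function has a unique minimizer,
characterized by a proximal fixed point equation. -/
theorem existsUnique_minimizer_add {X : Type*} [NormedAddCommGroup X] [InnerProductSpace ℝ X]
    [FiniteDimensional ℝ X] {D : X → ℝ} {G : X → EReal} {a : ℝ} (ha : 0 < a)
    (hD : Differentiable ℝ D)
    (h : ∀ x z, D x + inner ℝ (gradient D x) (z - x) + a / 2 * ‖z - x‖ ^ 2 ≤ D z)
    (hG : IsClosedConvexProper G) :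
    ∃! y, ∀ z, (D y : EReal) + G y ≤ (D z : EReal) + G z := by
  simp_rw [add_comm (D _ : EReal)]
  obtain ⟨y, hy⟩ := hG.exists_minimizer hD.continuous (κ := a / 2) (s := gradient D 0) (c := D 0)
    (by positivity) fun w => by
      have := h 0 w
      rw [sub_zero] at this
      linarith
  refine ⟨y, hy, fun z hz => ?_⟩
  -- For two minimizers the subgradients -∇D of `G` are monotone while ∇D is strongly monotone, so
  -- the points coincide.
  have h1 := (hG.isSubgradient_of_minimizer (hD z) hz).inner_nonneg
    (hG.isSubgradient_of_minimizer (hD y) hy)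
  have h2 := inner_gradient_sub_ge h z y
  rw [← neg_sub', inner_neg_left, real_inner_comm] at h1
  have h3 : ‖z - y‖ ^ 2 ≤ 0 := by
    by_contra! h4
    have : 0 < a * ‖z - y‖ ^ 2 := by positivity
    linarith
  have h4 : ‖z - y‖ = 0 := by simpa using le_antisymm h3 (sq_nonneg _)
  exact sub_eq_zero.1 (norm_eq_zero.1 h4)

/-- Optimality puts -∇D(y) in the subdifferential of `G` at y; scaled by γ, this is the optimality
condition of the proximal problem. -/
theorem prox_sub_smul_gradient_eq {X : Type*} [NormedAddCommGroup X] [InnerProductSpace ℝ X]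
    [FiniteDimensional ℝ X] {D : X → ℝ} {G : X → EReal} {γ : ℝ} (hγ : 0 < γ) {y : X}
    (hD : DifferentiableAt ℝ D y) (hG : IsClosedConvexProper G)
    (hy : ∀ z, (D y : EReal) + G y ≤ (D z : EReal) + G z) :
    prox (fun u => (γ : EReal) * G u) (y - γ • gradient D y) = y := by
  apply (hG.const_mul hγ).prox_eq_of_isSubgradient
  have h1 : y - γ • gradient D y - y = γ • -gradient D y := by
    rw [smul_neg]
    abel
  rw [h1]
  refine (hG.isSubgradient_of_minimizer hD fun z => ?_).const_mul hγ
  rw [add_comm, add_comm (G z)]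
  exact hy z

theorem pathDifferentiableOn_neg_apply_comp_adjoint {Θ : Set (E p)} {Ψ : E p × E n → E n}
    {K : E p → E n →L[ℝ] E m} (hΨ : PathDifferentiableOn (Θ ×ˢ univ) Ψ)
    (hK : PathDifferentiableOn Θ K) :
    PathDifferentiableOn (Θ ×ˢ univ)
      fun q : E p × E m => -K q.1 (Ψ (q.1, -adjoint (K q.1) q.2)) := by
  -- Over ℝ the adjoint is linear, so (A, y) ↦ A* y is smooth.
  let adj : (E n →L[ℝ] E m) →L[ℝ] (E m →L[ℝ] E n) := LinearMap.toContinuousLinearMap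
    { toFun := fun A => adjoint A
      map_add' := fun A B => map_add _ A B
      map_smul' := fun c A => by simp }
  have h1 : PathDifferentiableOn (Θ ×ˢ univ) fun q : E p × E m => (K q.1, q) :=
    (PathDifferentiableOn.comp (G := fun q : E p × E m => q.1) hK contDiff_fst.pathDifferentiableOn
      fun q hq => hq.1).prodMk contDiff_id.pathDifferentiableOn
  have hs : ContDiff ℝ 1 fun q : (E n →L[ℝ] E m) × (E p × E m) =>
      (q.1, (q.2.1, -adj q.1 q.2.2)) := by
    have : ContDiff ℝ 1 fun q : (E n →L[ℝ] E m) × (E p × E m) => adj q.1 q.2.2 :=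
      (adj.contDiff.comp contDiff_fst).clm_apply (contDiff_snd.comp contDiff_snd)
    fun_prop
  have h2 : PathDifferentiableOn (Θ ×ˢ univ)
      fun q : E p × E m => (K q.1, (q.1, -adj (K q.1) q.2)) :=
    PathDifferentiableOn.comp (D' := univ) (G := fun q : E p × E m => (K q.1, q))
      hs.pathDifferentiableOn h1 (mapsTo_univ _ _)
  have h3 : PathDifferentiableOn (univ ×ˢ (Θ ×ˢ univ))
      fun q : (E n →L[ℝ] E m) × (E p × E n) => (q.1, Ψ q.2) :=
    contDiff_fst.pathDifferentiableOn.prodMk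
      (PathDifferentiableOn.comp (G := fun q : (E n →L[ℝ] E m) × (E p × E n) => q.2) hΨ
        contDiff_snd.pathDifferentiableOn fun q hq => hq.2)
  have h4 : PathDifferentiableOn (Θ ×ˢ univ)
      fun q : E p × E m => (K q.1, Ψ (q.1, -adj (K q.1) q.2)) :=
    PathDifferentiableOn.comp (G := fun q : E p × E m => (K q.1, (q.1, -adj (K q.1) q.2)))
      h3 h2 fun q hq => ⟨mem_univ _, hq.1, mem_univ _⟩
  have h5 : ContDiff ℝ 1 fun q : (E n →L[ℝ] E m) × E n => -q.1 q.2 :=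
    (contDiff_fst.clm_apply contDiff_snd).neg
  exact PathDifferentiableOn.comp (D' := univ)
    (G := fun q : E p × E m => (K q.1, Ψ (q.1, -adj (K q.1) q.2)))
    h5.pathDifferentiableOn h4 (mapsTo_univ _ _)

end Dual

end DualPathDiff

/-! ### The main theorem -/

theorem theorem5p1 {p n m : ℕ} (Θ : Set (DualPathDiff.E p)) (hΘ_open : IsOpen Θ)
    (hΘ_conn : IsConnected Θ)
    (f : DualPathDiff.E p → DualPathDiff.E n → ℝ)
    (g : DualPathDiff.E p → DualPathDiff.E m → EReal)
    (K : DualPathDiff.E p → DualPathDiff.E n →L[ℝ] DualPathDiff.E m)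
    (α β lo hi : ℝ) (hα : 0 < α) (hβ : 0 < β) (hlo : 0 < lo) (hlohi : lo ≤ hi)
    (hf_convex : ∀ θ ∈ Θ, StrongConvexOn Set.univ α (f θ))
    (hf_smooth : ∀ θ ∈ Θ, DualPathDiff.HasLipschitzGradient β (f θ))
    (hg : ∀ θ ∈ Θ, DualPathDiff.IsClosedConvexProper (g θ))
    (hK_surj : ∀ θ ∈ Θ, Function.Surjective (K θ))
    (hK_sing : ∀ θ ∈ Θ, ∀ i < m,
      (K θ : DualPathDiff.E n →ₗ[ℝ] DualPathDiff.E m).singularValues i ∈ Set.Icc lo hi) :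
    -- regularity of the smooth part of the dual objective
    (∀ θ ∈ Θ,
      (∀ y, DualPathDiff.dualSmoothE (f θ) (K θ) y ≠ ⊤ ∧
        DualPathDiff.dualSmoothE (f θ) (K θ) y ≠ ⊥) ∧
      StrongConvexOn Set.univ (lo ^ 2 / β) (DualPathDiff.dualSmooth (f θ) (K θ)) ∧
      DualPathDiff.HasLipschitzGradient (hi ^ 2 / α) (DualPathDiff.dualSmooth (f θ) (K θ))) ∧
    -- path differentiability of the dual solution
    (∀ γ : ℝ, 0 < γ →
      (γ < 2 * (lo ^ 2 / β) / (lo ^ 2 / β + hi ^ 2 / α) ∨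
        γ < 2 * (lo ^ 2 / β) / (lo ^ 2 / β + hi ^ 2 / α) ^ 2) →
      DualPathDiff.PathDifferentiableOn (Θ ×ˢ Set.univ) (DualPathDiff.proxMap γ g) →
      DualPathDiff.PathDifferentiableOn (Θ ×ˢ Set.univ) (DualPathDiff.gradConj f) →
      DualPathDiff.PathDifferentiableOn Θ K →
      (∀ θ ∈ Θ, ∃! y, DualPathDiff.IsDualSolution (f θ) (g θ) (K θ) y) ∧
      ∀ ystar : DualPathDiff.E p → DualPathDiff.E m,
        (∀ θ ∈ Θ, DualPathDiff.IsDualSolution (f θ) (g θ) (K θ) (ystar θ)) →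
        DualPathDiff.PathDifferentiableOn Θ ystar ∧
        -- the matrices inverted in the formula are invertible
        (∀ θ ∈ Θ, ∀ (U W : DualPathDiff.E p →L[ℝ] DualPathDiff.E m)
          (V Z : DualPathDiff.E m →L[ℝ] DualPathDiff.E m),
          U.coprod V ∈ DualPathDiff.clarkeJacobian (DualPathDiff.proxMap γ g)
            (θ, ystar θ + γ • K θ (DualPathDiff.gradConj f
              (θ, -(ContinuousLinearMap.adjoint (K θ) (ystar θ))))) →
          W.coprod Z ∈ DualPathDiff.clarkeJacobian (DualPathDiff.gradDualSmooth f K)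
            (θ, ystar θ) →
          (ContinuousLinearMap.id ℝ (DualPathDiff.E m) -
            V ∘L (ContinuousLinearMap.id ℝ (DualPathDiff.E m) - γ • Z)).IsInvertible) ∧
        DualPathDiff.IsConservativeJacobian Θ ystar fun θ =>
          DualPathDiff.implicitJacobian γ
            (DualPathDiff.clarkeJacobian (DualPathDiff.proxMap γ g)
              (θ, ystar θ + γ • K θ (DualPathDiff.gradConj f
                (θ, -(ContinuousLinearMap.adjoint (K θ) (ystar θ))))))
            (DualPathDiff.clarkeJacobian (DualPathDiff.gradDualSmooth f K) (θ, ystar θ))) := by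

  have hreg := fun θ hθ => DualPathDiff.dualSmooth_regularity hα hβ hlo hlohi (hf_convex θ hθ)
    (hf_smooth θ hθ) (hK_surj θ hθ) (hK_sing θ hθ)
  refine ⟨fun θ hθ => ?_, fun γ hγ _ hT hF hK => ⟨fun θ hθ => ?_, fun ystar hy => ?_⟩⟩
  · obtain ⟨h1, -, h3, h4⟩ := hreg θ hθ
    exact ⟨fun y => by rw [h1]; exact ⟨EReal.coe_ne_top _, EReal.coe_ne_bot _⟩,
      DualPathDiff.strongConvexOn_of_add_inner_le h3, h4⟩
  · obtain ⟨h1, -, h3, h4⟩ := hreg θ hθ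
    simp only [DualPathDiff.IsDualSolution, h1]
    exact DualPathDiff.existsUnique_minimizer_add (by positivity) h4.1 h3 (hg θ hθ).conj
  · have ha : 0 < lo ^ 2 / β := by positivity
    have hb : 0 ≤ hi ^ 2 / α := by positivity
    have hgrad : ∀ θ ∈ Θ, ∀ y, DualPathDiff.gradDualSmooth f K (θ, y) =
        -K θ (DualPathDiff.gradConj f (θ, -(ContinuousLinearMap.adjoint (K θ) y))) :=
      fun θ hθ y => ((hreg θ hθ).2.1 y).gradient
    have hB : DualPathDiff.PathDifferentiableOn (Θ ×ˢ Set.univ)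
        (DualPathDiff.gradDualSmooth f K) :=
      (DualPathDiff.pathDifferentiableOn_neg_apply_comp_adjoint hF hK).congr
        fun q hq => hgrad q.1 hq.1 q.2
    have hTfirm : ∀ θ ∈ Θ, ∀ x y, ‖DualPathDiff.proxMap γ g (θ, x) -
        DualPathDiff.proxMap γ g (θ, y)‖ ^ 2 ≤
        inner ℝ (x - y) (DualPathDiff.proxMap γ g (θ, x) - DualPathDiff.proxMap γ g (θ, y)) :=
      fun θ hθ x y => ((hg θ hθ).conj.const_mul hγ).norm_prox_sub_prox_sq_le x y
    have hBmono : ∀ θ ∈ Θ, ∀ x y, lo ^ 2 / β * ‖x - y‖ ^ 2 ≤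
        inner ℝ (x - y) (DualPathDiff.gradDualSmooth f K (θ, x) -
          DualPathDiff.gradDualSmooth f K (θ, y)) :=
      fun θ hθ x y => DualPathDiff.inner_gradient_sub_ge
        (D := DualPathDiff.dualSmooth (f θ) (K θ)) (hreg θ hθ).2.2.1 x y
    have hfix : ∀ θ ∈ Θ, DualPathDiff.proxMap γ g
        (θ, ystar θ - γ • DualPathDiff.gradDualSmooth f K (θ, ystar θ)) = ystar θ := by
      intro θ hθ
      obtain ⟨h1, -, -, h4⟩ := hreg θ hθ
      have hsol := hy θ hθ
      simp only [DualPathDiff.IsDualSolution, h1] at hsol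
      exact DualPathDiff.prox_sub_smul_gradient_eq hγ (h4.1 _) (hg θ hθ).conj hsol
    -- The base point in the formula is the forward gradient step. The identity is known only on
    -- `Θ`, hence the later use of `congr_set`.
    have hpt : ∀ θ ∈ Θ, ystar θ + γ • K θ (DualPathDiff.gradConj f
        (θ, -(ContinuousLinearMap.adjoint (K θ) (ystar θ)))) =
        ystar θ - γ • DualPathDiff.gradDualSmooth f K (θ, ystar θ) := fun θ hθ => by
      rw [hgrad θ hθ, smul_neg, sub_neg_eq_add]
    have hBlip : ∀ θ ∈ Θ, ∀ x y, ‖DualPathDiff.gradDualSmooth f K (θ, x) -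
        DualPathDiff.gradDualSmooth f K (θ, y)‖ ≤ hi ^ 2 / α * ‖x - y‖ :=
      fun θ hθ => (hreg θ hθ).2.2.2.2
    have hcons₀ := DualPathDiff.isConservativeJacobian_of_fixedPoint
      (T := DualPathDiff.proxMap γ g) (B := DualPathDiff.gradDualSmooth f K) (ystar := ystar)
      hΘ_open hγ ha hb hT hB hTfirm hBmono hBlip hfix
    have hcons := hcons₀.congr_set (J' := fun θ =>
        DualPathDiff.implicitJacobian γ
          (DualPathDiff.clarkeJacobian (DualPathDiff.proxMap γ g)
            (θ, ystar θ + γ • K θ (DualPathDiff.gradConj f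
              (θ, -(ContinuousLinearMap.adjoint (K θ) (ystar θ))))))
          (DualPathDiff.clarkeJacobian (DualPathDiff.gradDualSmooth f K) (θ, ystar θ)))
      fun θ hθ => by rw [hpt θ hθ]
    refine ⟨⟨hcons.locallyLipschitz, _, hcons⟩, fun θ hθ U W V Z hUV hWZ => ?_, hcons⟩
    refine DualPathDiff.isInvertible_id_sub_comp hγ ha (fun w => ?_) fun v => ?_
    · simpa using DualPathDiff.norm_sq_le_inner_of_mem_clarkeJacobian hΘ_open hTfirm
        (q := (_, _)) hθ hUV w
    · simpa using DualPathDiff.le_inner_of_mem_clarkeJacobian hΘ_open hBmono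
        (q := (_, _)) hθ hWZ v
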